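/- Let $\psi:\mathbb R\to\mathbb R$ be perturbed strictly convex: $\psi=\psi_c+\delta\psi$, where $\psi_c$ is twice differentiable with $\psi_c''\ge c$ on $\mathbb R$ for some constant $c>0$, and $\delta\psi$ is differentiable with $\sup_{x\in\mathbb R}\bigl(|\delta\psi(x)|+|\delta\psi'(x)|\bigr)<\infty$. Put $$\varphi^*(\sigma)=\log\int_{\mathbb R}e^{\sigma x-\psi(x)}\,dx,\qquad \varphi(m)=\sup_{\sigma\in\mathbb R}\bigl(\sigma m-\varphi^*(\sigma)\bigr),\qquad \mu^\sigma(dx)=e^{-\varphi^*(\sigma)+\sigma x-\psi(x)}\,dx,$$ and, for integers $K\ge 1$, let $$\bar H_K(m)=-\frac1K\log\int_{X_{K,m}}\exp\Bigl(-\sum_{i=1}^K\psi(x_i)\Bigr)\,\mathcal H^{K-1}(dx),\qquad X_{K,m}=\Bigl\{x\in\mathbb R^K:\ \frac1K\sum_{i=1}^Kx_i=m\Bigr\},$$ where $\mathcal H^{K-1}$ is the $(K-1)$-dimensional Hausdorff measure. For every $m\in\mathbb R$ there is a unique $\sigma=\sigma(m)\in\mathbb R$ such that $\mu^{\sigma}$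 has mean $m$; let $s^2=s^2(m)=\int(x-m)^2\,\mu^{\sigma(m)}(dx)$ be its variance, which is positive. Then $\varphi$ is $C^2$, and there are a constant $C>0$ and an integer $K_0\ge 1$, both depending only on $\psi$, such that for all $K\ge K_0$ the function $\bar H_K$ is $C^2$ and, for all $m\in\mathbb R$, $$\Bigl|\frac{d^2}{dm^2}\varphi(m)-\frac{d^2}{dm^2}\bar H_K(m)\Bigr|\le\frac{C}{K\,s^2(m)}.$$ -/

import Mathlib

namespace CramerConvex

open MeasureTheory

/-- A single-site potential `ψ` is perturbed strictly convex: `ψ = ψc + δψ`, where `ψc` is twice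
differentiable with `ψc''` bounded below by a positive constant, and `δψ` is differentiable with
`|δψ| + |δψ'|` bounded. -/
def PerturbedStrictlyConvex (ψ : ℝ → ℝ) : Prop :=
  ∃ ψc δψ : ℝ → ℝ,
    (∀ x, ψ x = ψc x + δψ x) ∧
    Differentiable ℝ ψc ∧ Differentiable ℝ (deriv ψc) ∧
    (∃ c : ℝ, 0 < c ∧ ∀ x, c ≤ deriv (deriv ψc) x) ∧
    Differentiable ℝ δψ ∧
    ∃ C : ℝ, ∀ x, |δψ x| + |deriv δψ x| ≤ C

/-- `φ*(σ) = log ∫ exp (σ x - ψ x) dx`. -/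
noncomputable def logLaplace (ψ : ℝ → ℝ) (σ : ℝ) : ℝ :=
  Real.log (∫ x, Real.exp (σ * x - ψ x))

/-- The Cramér transform `φ(m) = sup_σ (σ m - φ*(σ))`. -/
noncomputable def cramerTransform (ψ : ℝ → ℝ) (m : ℝ) : ℝ :=
  ⨆ σ : ℝ, (σ * m - logLaplace ψ σ)

/-- The probability measure `μ^σ(dx) = exp (-φ*(σ) + σ x - ψ x) dx`, that is, the measure with
Lebesgue density `exp (σ x - ψ x) / ∫ exp (σ y - ψ y) dy`. -/
noncomputable def tiltedMeasure (ψ : ℝ → ℝ) (σ : ℝ) : Measure ℝ :=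
  (volume : Measure ℝ).tilted (fun x => σ * x - ψ x)

/-- The mean of `μ^σ`. -/
noncomputable def tiltedMean (ψ : ℝ → ℝ) (σ : ℝ) : ℝ :=
  ∫ x, x ∂(tiltedMeasure ψ σ)

/-- The variance `s²` of `μ^σ`. -/
noncomputable def tiltedVariance (ψ : ℝ → ℝ) (σ : ℝ) : ℝ :=
  ∫ x, (x - tiltedMean ψ σ) ^ 2 ∂(tiltedMeasure ψ σ)

/-- The noninteracting Hamiltonian `H(x) = ∑ i, ψ (x i)` on `ℝ^K`. -/
noncomputable def hamiltonian (ψ : ℝ → ℝ) {K : ℕ} (x : EuclideanSpace ℝ (Fin K)) : ℝ :=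
  ∑ i, ψ (x i)

/-- The hyperplane `X_{K,m}` of configurations in `ℝ^K` with mean spin `m`. -/
def meanHyperplane (K : ℕ) (m : ℝ) : Set (EuclideanSpace ℝ (Fin K)) :=
  {x | (1 / (K : ℝ)) * ∑ i, x i = m}

/-- The coarse-grained Hamiltonian
`H̄_K(m) = -(1/K) log ∫_{X_{K,m}} exp (-H(x)) ℋ^{K-1}(dx)`, with `ℋ^{K-1}` the `(K-1)`-dimensional
Hausdorff measure in its usual normalization (Lebesgue measure on `(K-1)`-dimensional planes).
It is used for `1 ≤ K` only. -/
noncomputable def coarseHamiltonian (ψ : ℝ → ℝ) (K : ℕ) (m : ℝ) : ℝ :=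
  -(1 / (K : ℝ)) * Real.log (∫ x in meanHyperplane K m, Real.exp (-hamiltonian ψ x)
    ∂(Measure.euclideanHausdorffMeasure (K - 1) : Measure (EuclideanSpace ℝ (Fin K))))

end CramerConvex

/-! The argument is a local Cramér theorem, uniform in the tilt. On the slice of mean `t` the tilt
contributes only the factor `exp (K σ t)`. So `-(1/K) log` of the tilted slice partition function
differs from `coarseHamiltonian ψ K` by a linear function of `t`, and for each `m` the tilt `σ` may
be chosen so that `μ^σ` has mean `m`. The tilted slice function is, up to a constant, the density of
the mean of `K` independent variables of law `μ^σ`, so its Fourier transform is a `K`-th power of a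
characteristic function (`exists_fourier_tiltedSlice`).

Let `ν` be the centred, unit-variance rescaling of `μ^σ` and `G j = ∫ x ^ j * charFun ν (x / √K) ^
K`. Fourier inversion at `t = m` gives `H̄'' = s⁻² (G 2 * G 0 - G 1 ^ 2) / G 0 ^ 2`
(`coarseHamiltonian_second_deriv`), while Legendre duality gives `φ'' = s⁻²` (`exists_tilt`). It
remains to see that `G 0` stays away from zero, `G 1 = O(1/√K)` and `G 2 - G 0 = O(1/K)`. For a
Gaussian `G 1` and `G 2 - G 0` vanish. The first Edgeworth correction, of order `1/√K`, is odd and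
drops out of `G 2 - G 0` (`exists_normalized_bounds`).

These bounds need only a fourth moment bound and the decay `‖charFun ν u‖ ≤ A / |u|`, both uniform
in `σ` (`PerturbedWell.exists_normalized`). The exponent of `μ^σ` is a convex well plus a fixed
bounded perturbation, and the partition function `Z` of the well serves as the length scale. Moments
are at most powers of `Z`, the variance is at least a multiple of `Z ^ 2`, and one integration by
parts gives the decay. -/

namespace CramerConvex

open MeasureTheory ProbabilityTheory Complex

/-! ### Characteristic functions: Gaussian-type bound and Taylor expansion. -/

section CharFun

variable {ν : Measure ℝ} [IsProbabilityMeasure ν]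

lemma integrable_cexp_mul_I (u : ℝ) : Integrable (fun x : ℝ => cexp (u * x * I)) ν := by
  refine Integrable.of_bound (C := 1) (by fun_prop) (ae_of_all _ fun x => ?_)
  rw [← ofReal_mul, norm_exp_ofReal_mul_I]

/-- After a rotation by the phase `θ` of `charFun ν u`, the norm is the mean of `cos (u x - θ)`.
Then `cos 2t ≥ 4 cos t - 3`, which is `2 (cos t - 1) ^ 2 ≥ 0`, is integrated. -/
lemma one_sub_norm_charFun_two_mul_le (u : ℝ) :
    1 - ‖charFun ν (2 * u)‖ ≤ 4 * (1 - ‖charFun ν u‖) := by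
  obtain ⟨θ, hθ⟩ : ∃ θ : ℝ, cexp (-(θ * I)) * charFun ν u = ‖charFun ν u‖ := by
    refine ⟨arg (charFun ν u), ?_⟩
    conv_lhs => rw [← norm_mul_exp_arg_mul_I (charFun ν u)]
    rw [mul_left_comm, ← Complex.exp_add]
    simp
  have key (a b : ℝ) : (cexp (-(b * I)) * charFun ν a).re = ∫ x, Real.cos (a * x - b) ∂ν := by
    rw [charFun_apply_real, ← integral_const_mul]
    rw [← RCLike.re_eq_complex_re, ← integral_re ((integrable_cexp_mul_I a).const_mul _)]
    refine integral_congr_ae (ae_of_all _ fun x => ?_)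
    change (_ : ℂ).re = _
    rw [← Complex.exp_add, show -(b * I) + a * x * I = ((a * x - b : ℝ) : ℂ) * I by push_cast; ring,
      exp_ofReal_mul_I_re]
  have hint (a b : ℝ) : Integrable (fun x => Real.cos (a * x - b)) ν :=
    Integrable.of_bound (C := 1) (by fun_prop) (ae_of_all _ fun x => Real.abs_cos_le_one _)
  have h1 : ‖charFun ν u‖ = ∫ x, Real.cos (u * x - θ) ∂ν := by
    rw [← key, hθ, ofReal_re]
  have h2 : (∫ x, Real.cos (2 * u * x - 2 * θ) ∂ν) ≤ ‖charFun ν (2 * u)‖ := by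
    have := key (2 * u) (2 * θ)
    rw [← this]
    refine (re_le_norm _).trans ?_
    rw [norm_mul, ← neg_mul, ← ofReal_neg, norm_exp_ofReal_mul_I, one_mul]
  have h3 : (∫ x, (4 * Real.cos (u * x - θ) - 3) ∂ν) ≤ ∫ x, Real.cos (2 * u * x - 2 * θ) ∂ν := by
    refine integral_mono (((hint _ _).const_mul _).sub (integrable_const _)) (hint _ _) fun x => ?_
    have : 2 * u * x - 2 * θ = 2 * (u * x - θ) := by ring
    simp only [this, Real.cos_two_mul]
    nlinarith [sq_nonneg (Real.cos (u * x - θ) - 1)]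
  rw [integral_sub ((hint _ _).const_mul _) (integrable_const _), integral_const_mul, ← h1] at h3
  simp at h3
  linarith

lemma one_sub_norm_charFun_two_pow_mul_le (u : ℝ) (n : ℕ) :
    1 - ‖charFun ν (2 ^ n * u)‖ ≤ 4 ^ n * (1 - ‖charFun ν u‖) := by
  induction n with
  | zero => simp
  | succ n ih =>
    have := one_sub_norm_charFun_two_mul_le (ν := ν) (2 ^ n * u)
    rw [pow_succ' 2, pow_succ' 4, mul_assoc, mul_assoc]
    linarith

/-- Decay of the characteristic function at infinity, via duplication, forces a uniform Gaussian
type bound near the origin. -/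
lemma sq_norm_charFun_mul_le {A : ℝ} (hA : 1 ≤ A)
    (h : ∀ u : ℝ, u ≠ 0 → ‖charFun ν u‖ ≤ A / |u|) (u : ℝ) :
    ‖charFun ν u‖ ^ 2 * (1 + u ^ 2 / (32 * A ^ 2)) ≤ 1 := by
  have hA0 : 0 < A := by linarith
  have hn := norm_nonneg (charFun ν u)
  rcases eq_or_ne u 0 with rfl | hu
  · simp
  have hu0 : 0 < |u| := abs_pos.2 hu
  rcases le_or_gt (2 * A) |u| with hR | hR
  · have h1 : ‖charFun ν u‖ * |u| ≤ A := (le_div_iff₀ hu0).1 (h u hu)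
    have h2 : ‖charFun ν u‖ ^ 2 * u ^ 2 ≤ A ^ 2 := by
      rw [← sq_abs u, ← mul_pow]
      exact pow_le_pow_left₀ (by positivity) h1 2
    have h3 : ‖charFun ν u‖ ≤ 1 / 2 := by
      refine (h u hu).trans ?_
      rw [div_le_iff₀ hu0]
      linarith
    have h4 : ‖charFun ν u‖ ^ 2 ≤ 1 / 4 := by nlinarith
    have h5 : ‖charFun ν u‖ ^ 2 * (u ^ 2 / (32 * A ^ 2)) ≤ 1 / 32 := by
      rw [← mul_div_assoc, div_le_iff₀ (by positivity)]
      linarith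
    linarith
  -- Here `2 ^ n ≤ 2A / |u| < 2 ^ (n + 1)`: after `n + 1` doublings the argument exceeds `2A`, where
  -- the decay hypothesis gives norm at most `1/2`, while `4 ^ (n + 1)` is still at most `16 A² /
  -- u²`.
  · obtain ⟨n, hn1, hn2⟩ := exists_nat_pow_near (x := 2 * A / |u|) (y := (2 : ℝ))
      (by rw [le_div_iff₀ hu0]; linarith) (by norm_num)
    have h1 := one_sub_norm_charFun_two_pow_mul_le (ν := ν) u (n + 1)
    have h2 : ‖charFun ν (2 ^ (n + 1) * u)‖ ≤ 1 / 2 := by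
      refine (h _ (by positivity)).trans ?_
      rw [abs_mul, abs_of_pos (by positivity : (0 : ℝ) < 2 ^ (n + 1)), div_le_iff₀ (by positivity)]
      rw [div_lt_iff₀ hu0] at hn2
      linarith
    have h3 : (4 : ℝ) ^ (n + 1) * u ^ 2 ≤ 16 * A ^ 2 := by
      have : 2 ^ n * |u| ≤ 2 * A := (le_div_iff₀ hu0).1 hn1
      have h5 := pow_le_pow_left₀ (by positivity) this 2
      rw [mul_pow, sq_abs, ← pow_mul, mul_comm n 2, pow_mul] at h5
      norm_num at h5
      rw [pow_succ]
      linarith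
    have h4 : u ^ 2 / (32 * A ^ 2) ≤ 1 - ‖charFun ν u‖ := by
      rw [div_le_iff₀ (by positivity)]
      have h6 : 1 / 2 ≤ 4 ^ (n + 1) * (1 - ‖charFun ν u‖) := by linarith
      have h7 : (0 : ℝ) < 4 ^ (n + 1) := by positivity
      have h8 : 0 ≤ 1 - ‖charFun ν u‖ := by
        by_contra hc
        push Not at hc
        nlinarith
      nlinarith [mul_le_mul_of_nonneg_right h3 h8, sq_nonneg u]
    set x := u ^ 2 / (32 * A ^ 2)
    have hx : 0 ≤ x := by positivity
    have : ‖charFun ν u‖ ≤ 1 - x := by linarith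
    have h9 := pow_le_pow_left₀ hn this 2
    nlinarith [mul_le_mul_of_nonneg_right h9 (by linarith : 0 ≤ 1 + x), mul_nonneg hx hx,
      mul_nonneg (mul_nonneg hx hx) (by linarith : 0 ≤ 1 - x)]

/-- Valid for all real `x`: for `|x| > 1` every term is dominated by `|x| ^ 4`, and the coefficients
`1 + 1 + 1 + 1/2 + 1/6` add up to less than `4`. -/
lemma norm_cexp_mul_I_sub_le (x : ℝ) :
    ‖cexp (x * I) - (1 + x * I - x ^ 2 / 2 - x ^ 3 * I / 6)‖ ≤ 4 * x ^ 4 := by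
  have hI3 : I ^ 3 = -I := by rw [pow_succ, I_sq]; ring
  have hsum : ∑ m ∈ Finset.range 4, ((x : ℂ) * I) ^ m / (m.factorial : ℂ) =
      1 + x * I - x ^ 2 / 2 - x ^ 3 * I / 6 := by
    simp only [Finset.sum_range_succ, Finset.sum_range_zero, mul_pow, hI3, I_sq, Nat.factorial]
    push_cast
    ring
  have hx4 : |x| ^ 4 = x ^ 4 := by rw [pow_abs, abs_of_nonneg]; positivity
  rcases le_or_gt |x| 1 with h | h
  · have hn : ‖(x : ℂ) * I‖ = |x| := by simp
    have := Complex.exp_bound (x := x * I) (n := 4) (by rw [hn]; exact h) (by norm_num)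
    rw [hsum, hn, hx4] at this
    refine this.trans ?_
    rw [mul_comm]
    refine mul_le_mul_of_nonneg_right ?_ (by positivity)
    norm_num [Nat.factorial]
  · have h1 : ‖cexp (x * I)‖ = 1 := norm_exp_ofReal_mul_I x
    have h2 : ‖(1 + x * I - x ^ 2 / 2 - x ^ 3 * I / 6 : ℂ)‖ ≤ 1 + |x| + |x| ^ 2 / 2 + |x| ^ 3 / 6 := by
      refine (norm_sub_le _ _).trans (add_le_add ((norm_sub_le _ _).trans
        (add_le_add ((norm_add_le _ _).trans ?_) ?_)) ?_) <;> simp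
    refine (norm_sub_le _ _).trans ?_
    rw [h1, ← hx4]
    have hp := one_le_pow₀ h.le (n := 2)
    have hp3 := one_le_pow₀ h.le (n := 3)
    have e2 : |x| ^ 2 ≤ |x| ^ 4 := pow_le_pow_right₀ h.le (by norm_num)
    have e3 : |x| ^ 3 ≤ |x| ^ 4 := pow_le_pow_right₀ h.le (by norm_num)
    have e1 : |x| ≤ |x| ^ 4 := le_self_pow₀ h.le (by norm_num)
    have e0 : 1 ≤ |x| ^ 4 := one_le_pow₀ h.le
    linarith

/-- Third order Taylor expansion of the characteristic function of a normalized law. -/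
lemma norm_charFun_sub_taylor_le (h4 : Integrable (fun x : ℝ => x ^ 4) ν)
    (hm : ∫ x, x ∂ν = 0) (hv : ∫ x, x ^ 2 ∂ν = 1) (u : ℝ) :
    ‖charFun ν u - (1 - u ^ 2 / 2 - (∫ x, x ^ 3 ∂ν : ℝ) * u ^ 3 * I / 6)‖
      ≤ 4 * (∫ x, x ^ 4 ∂ν) * u ^ 4 := by
  have hi (k : ℕ) (hk : k ≤ 4) : Integrable (fun x : ℝ => x ^ k) ν := by
    refine ((integrable_const (1 : ℝ)).add h4).mono' (by fun_prop) (ae_of_all _ fun x => ?_)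
    simp only [norm_pow, Real.norm_eq_abs, Pi.add_apply]
    have hx4 : |x| ^ 4 = x ^ 4 := by rw [pow_abs, abs_of_nonneg]; positivity
    rcases le_or_gt |x| 1 with h | h
    · have := pow_le_one₀ (n := k) (abs_nonneg x) h
      nlinarith [pow_nonneg (abs_nonneg x) 4]
    · have := pow_le_pow_right₀ h.le hk
      linarith
  have hic (k : ℕ) (hk : k ≤ 4) : Integrable (fun x : ℝ => (x : ℂ) ^ k) ν := by
    simpa using (hi k hk).ofReal (𝕜 := ℂ)
  have i1 : Integrable (fun x : ℝ => (u * x : ℂ) * I) ν := by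
    simpa using ((hic 1 (by norm_num)).const_mul (u : ℂ)).mul_const I
  have i2 : Integrable (fun x : ℝ => (u * x : ℂ) ^ 2 / 2) ν := by
    simpa [mul_pow] using ((hic 2 (by norm_num)).const_mul ((u : ℂ) ^ 2)).div_const 2
  have i3 : Integrable (fun x : ℝ => (u * x : ℂ) ^ 3 * I / 6) ν := by
    simpa [mul_pow] using (((hic 3 (by norm_num)).const_mul ((u : ℂ) ^ 3)).mul_const I).div_const 6
  have j1 : Integrable (fun x : ℝ => 1 + (u * x : ℂ) * I) ν := (integrable_const _).add i1
  have j2 : Integrable (fun x : ℝ => 1 + (u * x : ℂ) * I - (u * x : ℂ) ^ 2 / 2) ν := j1.sub i2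
  have j3 : Integrable (fun x : ℝ =>
      1 + (u * x : ℂ) * I - (u * x : ℂ) ^ 2 / 2 - (u * x : ℂ) ^ 3 * I / 6) ν := j2.sub i3
  have hpoly : ∫ x : ℝ, (1 + (u * x : ℂ) * I - (u * x : ℂ) ^ 2 / 2 - (u * x : ℂ) ^ 3 * I / 6) ∂ν =
      1 - u ^ 2 / 2 - (∫ x, x ^ 3 ∂ν : ℝ) * u ^ 3 * I / 6 := by
    rw [integral_sub j2 i3, integral_sub j1 i2, integral_add (integrable_const _) i1]
    simp only [mul_pow, integral_div, integral_mul_const, integral_const_mul]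
    have e1 : ∫ x : ℝ, (x : ℂ) ∂ν = 0 := by rw [integral_complex_ofReal, hm, ofReal_zero]
    have e2 : ∫ x : ℝ, (x : ℂ) ^ 2 ∂ν = 1 := by
      simp_rw [← ofReal_pow]; rw [integral_complex_ofReal, hv, ofReal_one]
    have e3 : ∫ x : ℝ, (x : ℂ) ^ 3 ∂ν = (∫ x, x ^ 3 ∂ν : ℝ) := by
      simp_rw [← ofReal_pow]; rw [integral_complex_ofReal]
    rw [e1, e2, e3]
    simp
    ring
  rw [← hpoly, charFun_apply_real, ← integral_sub (integrable_cexp_mul_I u) j3]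
  calc _ ≤ ∫ x, 4 * u ^ 4 * x ^ 4 ∂ν := by
        refine norm_integral_le_of_norm_le (h4.const_mul _) (ae_of_all _ fun x => ?_)
        have := norm_cexp_mul_I_sub_le (u * x)
        push_cast at this
        refine this.trans (le_of_eq (by ring))
    _ = _ := by rw [integral_const_mul]; ring

end CharFun

end CramerConvex

namespace CramerConvex

open MeasureTheory ProbabilityTheory Complex

/-! ### Comparison of powers, and the integrable envelope. -/

section Algebra

lemma norm_pow_sub_pow_le {a b : ℂ} {r : ℝ} (ha : ‖a‖ ≤ r) (hb : ‖b‖ ≤ r) (n : ℕ) :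
    ‖a ^ (n + 1) - b ^ (n + 1)‖ ≤ (n + 1) * r ^ n * ‖a - b‖ := by
  have hr : 0 ≤ r := (norm_nonneg a).trans ha
  induction n with
  | zero => simp
  | succ n ih =>
    have : a ^ (n + 1 + 1) - b ^ (n + 1 + 1) =
        a * (a ^ (n + 1) - b ^ (n + 1)) + b ^ (n + 1) * (a - b) := by ring
    rw [this]
    refine (norm_add_le _ _).trans ?_
    rw [norm_mul, norm_mul, norm_pow]
    have h1 : ‖a‖ * ‖a ^ (n + 1) - b ^ (n + 1)‖ ≤ r * ((n + 1) * r ^ n * ‖a - b‖) := by gcongr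
    have h2 : ‖b‖ ^ (n + 1) * ‖a - b‖ ≤ r ^ (n + 1) * ‖a - b‖ := by gcongr
    push_cast
    linarith [show r * ((n + 1) * r ^ n * ‖a - b‖) + r ^ (n + 1) * ‖a - b‖ =
      (n + 1 + 1) * r ^ (n + 1) * ‖a - b‖ by ring]

/-- Second-order Taylor remainder of the power map. Each induction step adds `n + 2` to the
coefficient, and `(n + 2) ^ 2 + (n + 2) ≤ (n + 3) ^ 2`. -/
lemma norm_pow_sub_pow_sub_mul_le {a b : ℂ} {r : ℝ} (ha : ‖a‖ ≤ r) (hb : ‖b‖ ≤ r) (n : ℕ) :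
    ‖a ^ (n + 2) - b ^ (n + 2) - (n + 2) * b ^ (n + 1) * (a - b)‖
      ≤ (n + 2) ^ 2 * r ^ n * ‖a - b‖ ^ 2 := by
  have hr : 0 ≤ r := (norm_nonneg a).trans ha
  induction n with
  | zero =>
    have : a ^ (0 + 2) - b ^ (0 + 2) - ((0 : ℕ) + 2) * b ^ (0 + 1) * (a - b) = (a - b) ^ 2 := by
      push_cast; ring
    rw [this, norm_pow]
    simp
    nlinarith [sq_nonneg ‖a - b‖]
  | succ n ih =>
    have : a ^ (n + 1 + 2) - b ^ (n + 1 + 2) - ((n + 1 : ℕ) + 2) * b ^ (n + 1 + 1) * (a - b) =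
        a * (a ^ (n + 2) - b ^ (n + 2) - (n + 2) * b ^ (n + 1) * (a - b))
          + (n + 2 : ℕ) * b ^ (n + 1) * (a - b) ^ 2 := by push_cast; ring
    rw [this]
    refine (norm_add_le _ _).trans ?_
    rw [norm_mul, norm_mul, norm_mul, norm_pow, norm_pow, norm_natCast]
    have h1 : ‖a‖ * ‖a ^ (n + 2) - b ^ (n + 2) - (n + 2) * b ^ (n + 1) * (a - b)‖
        ≤ r * ((n + 2) ^ 2 * r ^ n * ‖a - b‖ ^ 2) := by gcongr
    have h2 : ((n + 2 : ℕ) : ℝ) * ‖b‖ ^ (n + 1) * ‖a - b‖ ^ 2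
        ≤ (n + 2 : ℕ) * r ^ (n + 1) * ‖a - b‖ ^ 2 := by gcongr
    have h3 : 0 ≤ r ^ (n + 1) * ‖a - b‖ ^ 2 := by positivity
    push_cast at h2 ⊢
    calc _ ≤ ((n : ℝ) + 2) ^ 2 * (r ^ (n + 1) * ‖a - b‖ ^ 2)
            + (n + 2) * (r ^ (n + 1) * ‖a - b‖ ^ 2) := by
          refine (add_le_add h1 h2).trans (le_of_eq (by ring))
      _ ≤ _ := by nlinarith

lemma abs_exp_neg_sub_le {y : ℝ} (hy : 0 ≤ y) : |Real.exp (-y) - (1 - y)| ≤ y ^ 2 := by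
  rcases le_or_gt y 1 with h | h
  · have := Real.abs_exp_sub_one_sub_id_le (x := -y) (by rwa [abs_neg, abs_of_nonneg hy])
    rw [neg_sq] at this
    convert this using 2
    ring
  · have h1 := Real.add_one_le_exp (-y)
    have h2 : Real.exp (-y) ≤ 1 := Real.exp_le_one_iff.2 (by linarith)
    rw [abs_le]
    constructor <;> nlinarith

/-- The integrable envelope controlling all integrands in the local limit theorem. -/
noncomputable def envelope (c x : ℝ) : ℝ := ((1 + c * x ^ 2) ^ 6)⁻¹

lemma envelope_nonneg {c : ℝ} (hc : 0 ≤ c) (x : ℝ) : 0 ≤ envelope c x := by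
  unfold envelope; positivity

lemma continuous_envelope {c : ℝ} (hc : 0 ≤ c) : Continuous (envelope c) := by
  unfold envelope
  refine Continuous.inv₀ (by fun_prop) fun x => ?_
  positivity

/-- The envelope decays with degree `12`; degree `10` is spent on `|x| ^ j`, and `(1 + x ^ 2)⁻¹`
remains. -/
lemma integrable_abs_pow_mul_envelope {c : ℝ} (hc : 0 < c) (hc1 : c ≤ 1) {j : ℕ} (hj : j ≤ 10) :
    Integrable (fun x : ℝ => |x| ^ j * envelope c x) := by
  refine (integrable_inv_one_add_sq.const_mul ((c ^ 6)⁻¹)).mono'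
    (((continuous_abs.pow j).mul (continuous_envelope hc.le)).aestronglyMeasurable)
    (ae_of_all _ fun x => ?_)
  have h0 : 0 ≤ envelope c x := envelope_nonneg hc.le x
  rw [Real.norm_eq_abs, abs_mul, abs_of_nonneg h0, abs_pow, abs_abs]
  have h1 : |x| ^ j ≤ (1 + x ^ 2) ^ 5 := by
    rcases le_or_gt |x| 1 with h | h
    · exact (pow_le_one₀ (abs_nonneg x) h).trans (one_le_pow₀ (by nlinarith [sq_nonneg x]))
    · calc |x| ^ j ≤ |x| ^ 10 := pow_le_pow_right₀ h.le hj
        _ = (x ^ 2) ^ 5 := by rw [← sq_abs x, ← pow_mul]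
        _ ≤ _ := pow_le_pow_left₀ (sq_nonneg x) (by linarith) 5
  have h2 : c ^ 6 * (1 + x ^ 2) ^ 6 ≤ (1 + c * x ^ 2) ^ 6 := by
    rw [← mul_pow]
    exact pow_le_pow_left₀ (by positivity) (by nlinarith) 6
  unfold envelope
  have hp : 0 < 1 + x ^ 2 := by positivity
  calc |x| ^ j * ((1 + c * x ^ 2) ^ 6)⁻¹
      ≤ (1 + x ^ 2) ^ 5 * (c ^ 6 * (1 + x ^ 2) ^ 6)⁻¹ := by gcongr
    _ = (c ^ 6)⁻¹ * (1 + x ^ 2)⁻¹ := by field_simp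

lemma pow_le_envelope {c r x : ℝ} (hc : 0 ≤ c) {K : ℕ} (hK : 26 ≤ K) (hr : 0 ≤ r)
    (h : r ^ 2 * (1 + c * (x ^ 2 / K)) ≤ 1) : r ^ (K - 2) ≤ envelope (c / 24) x := by
  have hK0 : (0 : ℝ) < K := by positivity
  set y := c * (x ^ 2 / K) with hy
  have hy0 : 0 ≤ y := by positivity
  have hr1 : r ≤ 1 := by
    by_contra hc
    push Not at hc
    nlinarith
  -- Of the `K - 2` factors `r`, `12 q` are used: six blocks of `2 q`, each compensating one `(1 +
  -- y) ^ q`, which Bernoulli bounds below by `1 + q y`. The hypothesis `26 ≤ K` forces `q ≥ 2`,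
  -- whence `K ≤ 12 q + 13 ≤ 24 q`.
  obtain ⟨q, hq1, hq2⟩ : ∃ q : ℕ, 12 * q ≤ K - 2 ∧ K ≤ 24 * q := ⟨(K - 2) / 12, by omega, by omega⟩
  have h1 : 1 + c / 24 * x ^ 2 ≤ (1 + y) ^ q := by
    refine le_trans ?_ (one_add_mul_le_pow (by linarith) q)
    have : c / 24 * x ^ 2 = (K : ℝ) / 24 * y := by rw [hy]; field_simp
    rw [this]
    have h2 : (K : ℝ) ≤ 24 * q := by exact_mod_cast hq2
    nlinarith
  have h2 : r ^ (K - 2) ≤ r ^ (12 * q) := pow_le_pow_of_le_one hr hr1 hq1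
  refine h2.trans ?_
  unfold envelope
  rw [inv_eq_one_div, le_div_iff₀ (by positivity)]
  calc r ^ (12 * q) * (1 + c / 24 * x ^ 2) ^ 6
      ≤ r ^ (12 * q) * ((1 + y) ^ q) ^ 6 := by gcongr
    _ = (r ^ 2 * (1 + y)) ^ (q * 6) := by
        rw [mul_pow, ← pow_mul, ← pow_mul, show 12 * q = 2 * (q * 6) by ring]
    _ ≤ 1 := pow_le_one₀ (by positivity) h

end Algebra

/-! ### Pointwise Edgeworth expansion of `charFun ν (x / √K) ^ K`. -/

section Expansion

variable {ν : Measure ℝ} [IsProbabilityMeasure ν] {M A : ℝ} {K : ℕ}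

/-- The cubic correction in the Edgeworth expansion of the `K`-th power of a characteristic
function with third moment `κ`. -/
noncomputable def cubicCorrection (κ : ℝ) (K : ℕ) (x : ℝ) : ℂ :=
  K * cexp (-((x / √K : ℝ) : ℂ) ^ 2 / 2) ^ (K - 1) * (κ * ((x / √K : ℝ) : ℂ) ^ 3 * I / 6)

lemma cubicCorrection_neg (κ : ℝ) (K : ℕ) (x : ℝ) :
    cubicCorrection κ K (-x) = - cubicCorrection κ K x := by
  unfold cubicCorrection
  rw [neg_div]
  push_cast
  ring_nf

lemma continuous_cubicCorrection (κ : ℝ) (K : ℕ) : Continuous (cubicCorrection κ K) := by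
  unfold cubicCorrection
  fun_prop

/-- Centered laws of unit variance with quantitative fourth moment and characteristic function
bounds. -/
structure Normalized (ν : Measure ℝ) (M A : ℝ) : Prop where
  integrable : Integrable (fun x : ℝ => x ^ 4) ν
  mean : ∫ x, x ∂ν = 0
  variance : ∫ x, x ^ 2 ∂ν = 1
  moment : ∫ x, x ^ 4 ∂ν ≤ M
  decay : ∀ u : ℝ, u ≠ 0 → ‖charFun ν u‖ ≤ A / |u|

lemma abs_integral_pow_three_le (h4 : Integrable (fun x : ℝ => x ^ 4) ν) (hM : ∫ x, x ^ 4 ∂ν ≤ M) :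
    |∫ x, x ^ 3 ∂ν| ≤ 1 + M := by
  have : ∫ x, (1 + x ^ 4) ∂ν = 1 + ∫ x, x ^ 4 ∂ν := by
    rw [integral_add (integrable_const _) h4]; simp
  calc |∫ x, x ^ 3 ∂ν| ≤ ∫ x, (1 + x ^ 4) ∂ν := by
        rw [← Real.norm_eq_abs]
        refine norm_integral_le_of_norm_le ((integrable_const (1 : ℝ)).add h4)
          (ae_of_all _ fun x => ?_)
        rw [Real.norm_eq_abs, abs_le]
        constructor <;> nlinarith [sq_nonneg (x ^ 2 - x), sq_nonneg (x ^ 2 + x), sq_nonneg (x ^ 2 - 1),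
          sq_nonneg x]
    _ ≤ 1 + M := by linarith

set_option maxHeartbeats 1000000 in
/-- Pointwise comparison of a rescaled power of a characteristic function with its Gaussian limit
and with the first Edgeworth correction. -/
lemma Normalized.pointwise (h : Normalized ν M A) (hM : 0 ≤ M) (hA : 1 ≤ A) (hK : 26 ≤ K) (x : ℝ) :
    let c := 1 / (32 * A ^ 2) / 24
    ‖charFun ν (x / √K) ^ K‖ ≤ envelope c x ∧
    ‖charFun ν (x / √K) ^ K - cexp (-(x : ℂ) ^ 2 / 2)‖
      ≤ (5 * M + 5) * |x| ^ 3 / √K * envelope c x ∧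
    ‖charFun ν (x / √K) ^ K - cexp (-(x : ℂ) ^ 2 / 2) + cubicCorrection (∫ x, x ^ 3 ∂ν) K x‖
      ≤ (5 * M + 5) ^ 2 * (|x| ^ 4 + |x| ^ 6) / K * envelope c x := by
  intro c
  set κ := ∫ x, x ^ 3 ∂ν with hκ
  have hκM : |κ| ≤ 1 + M := abs_integral_pow_three_le h.integrable h.moment
  have hK0 : (0 : ℝ) < K := by positivity
  set v := x / √K with hv
  have hv2 : v ^ 2 = x ^ 2 / K := by rw [hv, div_pow, Real.sq_sqrt hK0.le]
  set a := charFun ν v with ha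
  set b := cexp (-(v : ℂ) ^ 2 / 2) with hb
  have hbr : b = (Real.exp (-(v ^ 2 / 2)) : ℝ) := by rw [hb]; push_cast; ring_nf
  have hb0 : ‖b‖ = Real.exp (-(v ^ 2 / 2)) := by
    rw [hbr, norm_real, Real.norm_of_nonneg (Real.exp_pos _).le]
  set y := 1 / (32 * A ^ 2) * (x ^ 2 / K) with hy
  have hc1 : 1 / (32 * A ^ 2) ≤ 1 := by
    rw [div_le_one (by positivity)]; nlinarith
  have hy0 : 0 ≤ y := by positivity
  -- One majorant for both `a = charFun ν v` and the Gaussian factor `b`, as the power comparisons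
  -- require; its high powers lie below the envelope.
  set r := √((1 + y)⁻¹) with hr
  have hr0 : 0 ≤ r := Real.sqrt_nonneg _
  have hr2 : r ^ 2 = (1 + y)⁻¹ := Real.sq_sqrt (by positivity)
  have har : ‖a‖ ≤ r := by
    refine Real.le_sqrt_of_sq_le ?_
    rw [inv_eq_one_div, le_div_iff₀ (by positivity)]
    have := sq_norm_charFun_mul_le hA h.decay v
    rw [hv2] at this
    rwa [show x ^ 2 / K / (32 * A ^ 2) = y by rw [hy]; ring] at this
  have hbr' : ‖b‖ ≤ r := by
    refine Real.le_sqrt_of_sq_le ?_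
    rw [hb0, ← Real.exp_nat_mul, show ((2 : ℕ) : ℝ) * -(v ^ 2 / 2) = - v ^ 2 by push_cast; ring,
      Real.exp_neg]
    refine inv_anti₀ (by positivity) ?_
    have := Real.add_one_le_exp (v ^ 2)
    have h1 : y ≤ v ^ 2 := by
      rw [hv2, hy]
      exact mul_le_of_le_one_left (by positivity) hc1
    linarith
  have hr1 : r ≤ 1 := by
    refine Real.sqrt_le_one.2 ?_
    exact inv_le_one_of_one_le₀ (by linarith)
  have henv : r ^ (K - 2) ≤ envelope c x :=
    pow_le_envelope (by positivity) hK hr0 (by rw [hr2, inv_mul_cancel₀ (by positivity)])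
  have henv1 : r ^ (K - 1) ≤ envelope c x := (pow_le_pow_of_le_one hr0 hr1 (by omega)).trans henv
  have henv0 : r ^ K ≤ envelope c x := (pow_le_pow_of_le_one hr0 hr1 (by omega)).trans henv
  have hpowb : b ^ K = cexp (-(x : ℂ) ^ 2 / 2) := by
    rw [hb, ← Complex.exp_nat_mul]
    congr 1
    have : (v : ℂ) ^ 2 = (x : ℂ) ^ 2 / K := by exact_mod_cast congrArg ((↑) : ℝ → ℂ) hv2
    rw [this]
    have : (K : ℂ) ≠ 0 := by exact_mod_cast hK0.ne'
    field_simp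
  have hv4 : |v| ^ 4 = |x| ^ 4 / K ^ 2 := by
    rw [show |v| ^ 4 = (|v| ^ 2) ^ 2 by ring, sq_abs, hv2, div_pow, ← sq_abs x]; ring
  have hv6 : |v| ^ 6 = |x| ^ 6 / K ^ 3 := by
    rw [show |v| ^ 6 = (|v| ^ 2) ^ 3 by ring, sq_abs, hv2, div_pow, ← sq_abs x]; ring
  have hv3 : |v| ^ 3 = |x| ^ 3 / (K * √K) := by
    rw [hv, abs_div, abs_of_nonneg (Real.sqrt_nonneg _), div_pow]
    congr 1
    rw [pow_succ, Real.sq_sqrt hK0.le]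
  have hd4 : ‖a - b + κ * v ^ 3 * I / 6‖ ≤ (4 * M + 1) * |v| ^ 4 := by
    have e1 := norm_charFun_sub_taylor_le h.integrable h.mean h.variance v
    have e2 := abs_exp_neg_sub_le (y := v ^ 2 / 2) (by positivity)
    have e3 : ‖b - (1 - v ^ 2 / 2)‖ ≤ (v ^ 2 / 2) ^ 2 := by
      rw [hbr, show ((Real.exp (-(v ^ 2 / 2)) : ℝ) : ℂ) - (1 - v ^ 2 / 2) =
        ((Real.exp (-(v ^ 2 / 2)) - (1 - v ^ 2 / 2) : ℝ) : ℂ) by push_cast; ring, norm_real]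
      exact e2
    rw [show a - b + κ * v ^ 3 * I / 6 = (a - (1 - v ^ 2 / 2 - κ * v ^ 3 * I / 6))
      - (b - (1 - v ^ 2 / 2)) by ring]
    refine (norm_sub_le _ _).trans ((add_le_add e1 e3).trans ?_)
    have hv4' : |v| ^ 4 = v ^ 4 := by rw [pow_abs, abs_of_nonneg]; positivity
    have := h.moment
    rw [hv4']
    nlinarith [show 0 ≤ v ^ 4 by positivity]
  -- For `|v| ≤ 1` this is the Taylor bound with the cubic term put back; for `|v| > 1` it follows
  -- from `‖a - b‖ ≤ 2`.
  have hd3 : ‖a - b‖ ≤ (5 * M + 5) * |v| ^ 3 := by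
    rcases le_or_gt |v| 1 with hv1 | hv1
    · have e1 : ‖(κ * v ^ 3 * I / 6 : ℂ)‖ = |κ| * |v| ^ 3 / 6 := by simp
      have e2 : ‖a - b‖ ≤ ‖a - b + κ * v ^ 3 * I / 6‖ + ‖(κ * v ^ 3 * I / 6 : ℂ)‖ := by
        have := norm_sub_le (a - b + κ * v ^ 3 * I / 6) (κ * v ^ 3 * I / 6)
        rwa [add_sub_cancel_right] at this
      have e3 : |v| ^ 4 ≤ |v| ^ 3 := pow_le_pow_of_le_one (abs_nonneg _) hv1 (by norm_num)
      have e4 : 0 ≤ |v| ^ 3 := by positivity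
      rw [e1] at e2
      nlinarith [mul_le_mul_of_nonneg_right hκM e4, mul_nonneg hM e4]
    · have e1 := norm_sub_le a b
      have e2 : 1 ≤ |v| ^ 3 := one_le_pow₀ hv1.le
      nlinarith
  obtain ⟨n, rfl⟩ : ∃ n, K = n + 2 := ⟨K - 2, by omega⟩
  simp only [show n + 2 - 1 = n + 1 by omega, show n + 2 - 2 = n by omega] at henv henv1
  have hE : 0 ≤ envelope c x := envelope_nonneg (by positivity) x
  refine ⟨?_, ?_, ?_⟩
  · rw [norm_pow]
    exact (pow_le_pow_left₀ (norm_nonneg _) har _).trans henv0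
  · rw [← hpowb]
    have := norm_pow_sub_pow_le har hbr' (n + 1)
    refine this.trans ?_
    calc ((n + 1 : ℕ) + 1 : ℝ) * r ^ (n + 1) * ‖a - b‖
        ≤ ((n + 1 : ℕ) + 1 : ℝ) * envelope c x * ((5 * M + 5) * |v| ^ 3) := by gcongr
      _ = _ := by
        rw [hv3]
        push_cast
        field_simp
        ring
  · rw [← hpowb]
    have e1 := norm_pow_sub_pow_sub_mul_le har hbr' n
    -- Two errors remain: the quadratic remainder of the power map, of size `K² ‖a - b‖²` with `‖a -
    -- b‖ = O(|v| ^ 3)`, and `K` times the fourth-order Taylor error of `a - b`. Both are `O(1/K)`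
    -- since `v = x / √K`.
    have e2 : a ^ (n + 2) - b ^ (n + 2) + cubicCorrection κ (n + 2) x =
        (a ^ (n + 2) - b ^ (n + 2) - (n + 2) * b ^ (n + 1) * (a - b))
          + (n + 2 : ℕ) * b ^ (n + 1) * (a - b + κ * v ^ 3 * I / 6) := by
      rw [cubicCorrection, show n + 2 - 1 = n + 1 by omega, ← hv, ← hb]
      push_cast
      ring
    rw [e2]
    refine (norm_add_le _ _).trans ?_
    rw [norm_mul, norm_mul, Complex.norm_natCast, norm_pow]
    have e3 : ((n : ℝ) + 2) ^ 2 * r ^ n * ‖a - b‖ ^ 2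
        ≤ (n + 2) ^ 2 * envelope c x * ((5 * M + 5) * |v| ^ 3) ^ 2 := by gcongr
    have e4 : ((n + 2 : ℕ) : ℝ) * ‖b‖ ^ (n + 1) * ‖a - b + κ * v ^ 3 * I / 6‖
        ≤ (n + 2 : ℕ) * envelope c x * ((5 * M + 5) ^ 2 * |v| ^ 4) := by
      have : ‖b‖ ^ (n + 1) ≤ envelope c x :=
        (pow_le_pow_left₀ (norm_nonneg _) hbr' _).trans henv1
      have : (4 * M + 1) * |v| ^ 4 ≤ (5 * M + 5) ^ 2 * |v| ^ 4 :=
        mul_le_mul_of_nonneg_right (by nlinarith) (by positivity)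
      have := hd4.trans this
      gcongr
    refine (add_le_add (e1.trans e3) e4).trans (le_of_eq ?_)
    rw [mul_pow _ (|v| ^ 3), ← pow_mul, show 3 * 2 = 6 by norm_num, hv6, hv4]
    push_cast
    field_simp
    ring

end Expansion
end CramerConvex

namespace CramerConvex

open MeasureTheory ProbabilityTheory Complex

/-! ### Gaussian integrals and the integrated Edgeworth bounds. -/

section Integrated

lemma integrable_pow_mul_gaussian (j : ℕ) :
    Integrable (fun x : ℝ => (x : ℂ) ^ j * cexp (-(x : ℂ) ^ 2 / 2)) := by
  have h := integrable_rpow_mul_exp_neg_mul_sq (b := 1 / 2) (by norm_num) (s := j)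
    (by have : (0 : ℝ) ≤ j := by positivity
        linarith)
  have h2 : Integrable fun x : ℝ =>
      ((x ^ (j : ℝ) * Real.exp (-(1 / 2) * x ^ 2) : ℝ) : ℂ) := h.ofReal
  refine h2.congr (ae_of_all _ fun x => ?_)
  simp only [Real.rpow_natCast]
  rw [show -(1 / 2) * x ^ 2 = -x ^ 2 / 2 by ring]
  push_cast
  ring

lemma integral_gaussian_half : ∫ x : ℝ, cexp (-(x : ℂ) ^ 2 / 2) = (√(2 * Real.pi) : ℝ) := by
  have h := integral_gaussian (1 / 2)
  rw [show Real.pi / (1 / 2) = 2 * Real.pi by ring] at h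
  rw [← h, ← integral_complex_ofReal]
  refine integral_congr_ae (ae_of_all _ fun x => ?_)
  push_cast
  congr 1
  ring

lemma integral_sq_mul_gaussian_half :
    ∫ x : ℝ, (x : ℂ) ^ 2 * cexp (-(x : ℂ) ^ 2 / 2) = ∫ x : ℝ, cexp (-(x : ℂ) ^ 2 / 2) := by
  have hd (x : ℝ) : HasDerivAt (fun x : ℝ => cexp (-(x : ℂ) ^ 2 / 2))
      (-(x : ℂ) * cexp (-(x : ℂ) ^ 2 / 2)) x := by
    have := (((hasDerivAt_id x).ofReal_comp.pow 2).neg.div_const 2).cexp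
    convert this using 1
    · funext y; simp
    · simp; ring
  have h := integral_mul_deriv_eq_deriv_mul_of_integrable (A := ℂ)
    (u := fun x : ℝ => (x : ℂ)) (u' := fun _ => 1)
    (v := fun x : ℝ => cexp (-(x : ℂ) ^ 2 / 2)) (v' := fun x : ℝ => -(x : ℂ) * cexp (-(x : ℂ) ^ 2 / 2))
    (fun x _ => (hasDerivAt_id x).ofReal_comp) (fun x _ => hd x)
    (by
      refine (integrable_pow_mul_gaussian 2).neg.congr (ae_of_all _ fun x => ?_)
      simp; ring)
    (by
      refine (integrable_pow_mul_gaussian 0).congr (ae_of_all _ fun x => ?_)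
      simp)
    (by
      refine (integrable_pow_mul_gaussian 1).congr (ae_of_all _ fun x => ?_)
      simp)
  simp only [one_mul] at h
  rw [← neg_inj, ← h, ← integral_neg]
  refine integral_congr_ae (ae_of_all _ fun x => ?_)
  ring

lemma integral_eq_zero_of_odd {f : ℝ → ℂ} (hf : ∀ x, f (-x) = -f x) : ∫ x, f x = 0 := by
  have h := integral_neg_eq_self f volume
  simp_rw [hf, integral_neg] at h
  exact self_eq_neg.1 h.symm

variable {ν : Measure ℝ} [IsProbabilityMeasure ν] {M A : ℝ} {K : ℕ}

lemma scale_pos (hA : 1 ≤ A) : 0 < 1 / (32 * A ^ 2) / 24 := by positivity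

lemma scale_le_one (hA : 1 ≤ A) : 1 / (32 * A ^ 2) / 24 ≤ 1 := by
  rw [div_div, div_le_one (by positivity)]
  nlinarith

lemma continuous_charFun_pow : Continuous fun x : ℝ => charFun ν (x / √K) ^ K :=
  ((continuous_charFun (μ := ν)).comp (continuous_id.div_const _)).pow K

lemma Normalized.integrable_pow_mul (h : Normalized ν M A) (hM : 0 ≤ M) (hA : 1 ≤ A) (hK : 26 ≤ K)
    {j : ℕ} (hj : j ≤ 10) : Integrable (fun x : ℝ => (x : ℂ) ^ j * charFun ν (x / √K) ^ K) := by
  refine (integrable_abs_pow_mul_envelope (scale_pos hA) (scale_le_one hA) hj).mono'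
    (((by fun_prop : Continuous fun x : ℝ => (x : ℂ) ^ j).mul
      continuous_charFun_pow).aestronglyMeasurable) (ae_of_all _ fun x => ?_)
  rw [norm_mul, norm_pow, norm_real, Real.norm_eq_abs]
  exact mul_le_mul_of_nonneg_left (h.pointwise hM hA hK x).1 (by positivity)

/-- Integrated form of the Edgeworth comparison: the zeroth, first and second moments of the
`K`-th power of a normalized characteristic function. -/
theorem exists_normalized_bounds (hM : 0 ≤ M) (hA : 1 ≤ A) : ∃ C : ℝ, 0 < C ∧ ∃ K₀ : ℕ, 26 ≤ K₀ ∧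
    ∀ (ν : Measure ℝ) [IsProbabilityMeasure ν], Normalized ν M A → ∀ K : ℕ, K₀ ≤ K →
      1 ≤ ‖∫ x : ℝ, charFun ν (x / √K) ^ K‖ ∧
      ‖∫ x : ℝ, (x : ℂ) * charFun ν (x / √K) ^ K‖ ≤ C / √K ∧
      ‖(∫ x : ℝ, (x : ℂ) ^ 2 * charFun ν (x / √K) ^ K) - ∫ x : ℝ, charFun ν (x / √K) ^ K‖
        ≤ C / K := by
  set c := 1 / (32 * A ^ 2) / 24 with hc
  set E : ℕ → ℝ := fun j => ∫ x : ℝ, |x| ^ j * envelope c x with hE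
  have hEi (j : ℕ) (hj : j ≤ 10) : Integrable fun x : ℝ => |x| ^ j * envelope c x :=
    integrable_abs_pow_mul_envelope (scale_pos hA) (scale_le_one hA) hj
  have hE0 (j : ℕ) : 0 ≤ E j := integral_nonneg fun x =>
    mul_nonneg (by positivity) (envelope_nonneg (scale_pos hA).le x)
  set D := (5 * M + 5) * E 3 + (5 * M + 5) * E 4 + (5 * M + 5) ^ 2 * (E 4 + 2 * E 6 + E 8) with hD
  have hD0 : 0 ≤ D := by
    have := hE0 3; have := hE0 4; have := hE0 6; have := hE0 8
    positivity
  obtain ⟨n, hn⟩ := exists_nat_ge (D ^ 2)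
  -- Since `n ≥ D ^ 2`, every admissible `K` has `D ≤ √K`. The crude error in the zeroth moment is
  -- then at most `1`, which with `√(2π) ≥ 2` leaves the lower bound `1`.
  refine ⟨D + 1, by linarith, n + 26, by omega, ?_⟩
  intro ν _ h K hK
  have hK26 : 26 ≤ K := by omega
  have hK0 : (0 : ℝ) < K := by positivity
  have hs0 : 0 < √K := Real.sqrt_pos.2 hK0
  have hDK : D ≤ √K := by
    refine Real.le_sqrt_of_sq_le (hn.trans ?_)
    exact_mod_cast (by omega : n ≤ K)
  have hp := h.pointwise hM hA hK26
  simp only [← hc] at hp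
  have hI (j : ℕ) (hj : j ≤ 10) := h.integrable_pow_mul hM hA hK26 hj
  have hG := integrable_pow_mul_gaussian
  have crude (j : ℕ) (hj : j ≤ 7) : ‖(∫ x : ℝ, (x : ℂ) ^ j * charFun ν (x / √K) ^ K)
      - ∫ x : ℝ, (x : ℂ) ^ j * cexp (-(x : ℂ) ^ 2 / 2)‖ ≤ (5 * M + 5) * E (j + 3) / √K := by
    rw [← integral_sub (hI j (by omega)) (hG j)]
    calc _ ≤ ∫ x : ℝ, (5 * M + 5) / √K * (|x| ^ (j + 3) * envelope c x) := by
          refine norm_integral_le_of_norm_le ((hEi (j + 3) (by omega)).const_mul _)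
            (ae_of_all _ fun x => ?_)
          rw [← mul_sub, norm_mul, norm_pow, norm_real, Real.norm_eq_abs]
          refine (mul_le_mul_of_nonneg_left (hp x).2.1 (by positivity)).trans (le_of_eq ?_)
          ring
      _ = _ := by rw [integral_const_mul]; ring
  have c0 := crude 0 (by norm_num)
  have c1 := crude 1 (by norm_num)
  simp only [pow_zero, one_mul, pow_one] at c0 c1
  refine ⟨?_, ?_, ?_⟩
  · rw [integral_gaussian_half] at c0
    have e1 : (2 : ℝ) ≤ √(2 * Real.pi) := by
      refine Real.le_sqrt_of_sq_le ?_
      have := Real.pi_gt_three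
      linarith
    have e2 : (5 * M + 5) * E 3 / √K ≤ 1 := by
      rw [div_le_one hs0]
      refine le_trans ?_ hDK
      have := hE0 4; have := hE0 6; have := hE0 8
      rw [hD]
      have : 0 ≤ (5 * M + 5) * E 4 + (5 * M + 5) ^ 2 * (E 4 + 2 * E 6 + E 8) := by positivity
      linarith
    have e3 : ‖((√(2 * Real.pi) : ℝ) : ℂ)‖ = √(2 * Real.pi) := by
      rw [norm_real, Real.norm_of_nonneg (Real.sqrt_nonneg _)]
    have e4 := norm_sub_norm_le ((√(2 * Real.pi) : ℝ) : ℂ) (∫ x : ℝ, charFun ν (x / √K) ^ K)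
    rw [norm_sub_rev, e3] at e4
    simp only [zero_add] at c0
    linarith
  · have e1 : ∫ x : ℝ, (x : ℂ) * cexp (-(x : ℂ) ^ 2 / 2) = 0 :=
      integral_eq_zero_of_odd fun x => by push_cast; ring_nf
    rw [e1, sub_zero] at c1
    refine c1.trans (div_le_div_of_nonneg_right ?_ hs0.le)
    have := hE0 3; have := hE0 4; have := hE0 6; have := hE0 8
    have : 0 ≤ (5 * M + 5) * E 3 + (5 * M + 5) ^ 2 * (E 4 + 2 * E 6 + E 8) := by positivity
    rw [hD]
    simp only [show 1 + 3 = 4 by norm_num]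
    linarith
  · set κ := ∫ x, x ^ 3 ∂ν
    set F : ℝ → ℂ := fun x =>
      charFun ν (x / √K) ^ K - cexp (-(x : ℂ) ^ 2 / 2) + cubicCorrection κ K x with hF
    -- The weight `x ^ 2 - 1` annihilates the Gaussian, and being even it annihilates the odd cubic
    -- correction too. Both can be inserted at no cost, so only the `O(1/K)` remainder `F`
    -- contributes.
    have hg : ∫ x : ℝ, ((x : ℂ) ^ 2 - 1) * cexp (-(x : ℂ) ^ 2 / 2) = 0 := by
      simp_rw [sub_mul, one_mul]
      rw [integral_sub (hG 2) (by simpa using hG 0), integral_sq_mul_gaussian_half, sub_self]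
    have ht : ∫ x : ℝ, ((x : ℂ) ^ 2 - 1) * cubicCorrection κ K x = 0 :=
      integral_eq_zero_of_odd fun x => by rw [cubicCorrection_neg]; push_cast; ring
    have hB : Integrable fun x : ℝ => (5 * M + 5) ^ 2 / K *
        (|x| ^ 4 * envelope c x + 2 * (|x| ^ 6 * envelope c x) + |x| ^ 8 * envelope c x) :=
      (((hEi 4 (by norm_num)).add ((hEi 6 (by norm_num)).const_mul 2)).add
        (hEi 8 (by norm_num))).const_mul _
    have hbound (x : ℝ) : ‖((x : ℂ) ^ 2 - 1) * F x‖ ≤ (5 * M + 5) ^ 2 / K *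
        (|x| ^ 4 * envelope c x + 2 * (|x| ^ 6 * envelope c x) + |x| ^ 8 * envelope c x) := by
      rw [norm_mul]
      have e1 : ‖(x : ℂ) ^ 2 - 1‖ ≤ |x| ^ 2 + 1 := by
        refine (norm_sub_le _ _).trans (le_of_eq ?_)
        rw [norm_pow, norm_real, Real.norm_eq_abs, norm_one]
      have e2 := (hp x).2.2
      calc _ ≤ (|x| ^ 2 + 1) * ((5 * M + 5) ^ 2 * (|x| ^ 4 + |x| ^ 6) / K * envelope c x) := by
            gcongr
        _ = _ := by ring
    have hFc : Continuous F :=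
      (continuous_charFun_pow.sub (by fun_prop)).add (continuous_cubicCorrection κ K)
    have hFi : Integrable fun x : ℝ => ((x : ℂ) ^ 2 - 1) * F x :=
      hB.mono' (((by fun_prop : Continuous fun x : ℝ => (x : ℂ) ^ 2 - 1).mul
        hFc).aestronglyMeasurable) (ae_of_all _ hbound)
    have hI' : Integrable fun x : ℝ => ((x : ℂ) ^ 2 - 1) * charFun ν (x / √K) ^ K := by
      simp_rw [sub_mul, one_mul]
      exact (hI 2 (by norm_num)).sub (by simpa using hI 0 (by norm_num))
    have hG' : Integrable fun x : ℝ => ((x : ℂ) ^ 2 - 1) * cexp (-(x : ℂ) ^ 2 / 2) := by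
      simp_rw [sub_mul, one_mul]
      exact (hG 2).sub (by simpa using hG 0)
    have hT' : Integrable fun x : ℝ => ((x : ℂ) ^ 2 - 1) * cubicCorrection κ K x := by
      refine ((hFi.sub hI').add hG').congr (ae_of_all _ fun x => ?_)
      simp only [hF, Pi.add_apply, Pi.sub_apply]
      ring
    have hmain : (∫ x : ℝ, (x : ℂ) ^ 2 * charFun ν (x / √K) ^ K) - ∫ x : ℝ, charFun ν (x / √K) ^ K
        = ∫ x : ℝ, ((x : ℂ) ^ 2 - 1) * F x := by
      rw [← integral_sub (hI 2 (by norm_num)) (by simpa using hI 0 (by norm_num))]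
      have e : ∀ x : ℝ, ((x : ℂ) ^ 2 - 1) * F x = (((x : ℂ) ^ 2 - 1) * charFun ν (x / √K) ^ K
          - ((x : ℂ) ^ 2 - 1) * cexp (-(x : ℂ) ^ 2 / 2))
          + ((x : ℂ) ^ 2 - 1) * cubicCorrection κ K x := fun x => by rw [hF]; ring
      simp_rw [e]
      have hIG : Integrable fun x : ℝ => ((x : ℂ) ^ 2 - 1) * charFun ν (x / √K) ^ K
          - ((x : ℂ) ^ 2 - 1) * cexp (-(x : ℂ) ^ 2 / 2) := hI'.sub hG'
      rw [integral_add hIG hT', integral_sub hI' hG', hg, ht, sub_zero, add_zero]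
      simp_rw [sub_mul, one_mul]
    rw [hmain]
    refine (norm_integral_le_of_norm_le hB (ae_of_all _ hbound)).trans ?_
    have h46 : Integrable fun x : ℝ => |x| ^ 4 * envelope c x + 2 * (|x| ^ 6 * envelope c x) :=
      (hEi 4 (by norm_num)).add ((hEi 6 (by norm_num)).const_mul 2)
    rw [integral_const_mul, integral_add h46 (hEi 8 (by norm_num)), integral_add (hEi 4 (by norm_num)) ((hEi 6 (by norm_num)).const_mul 2), integral_const_mul]
    rw [div_mul_eq_mul_div]
    refine div_le_div_of_nonneg_right ?_ hK0.le
    have := hE0 3; have := hE0 4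
    have : 0 ≤ (5 * M + 5) * E 3 + (5 * M + 5) * E 4 := by positivity
    change (5 * M + 5) ^ 2 * (E 4 + 2 * E 6 + E 8) ≤ D + 1
    linarith

end Integrated
end CramerConvex

/-! ### Convex wells: decay, moments and total variation on the scale of the partition function. -/

namespace CramerConvex

open MeasureTheory ProbabilityTheory Set

/-- A differentiable convex function with minimum value `0` attained at `x₀` and quadratic growth
of rate `c`. -/
structure ConvexWell (U : ℝ → ℝ) (x₀ c : ℝ) : Prop where
  differentiable : Differentiable ℝ U
  monotone : Monotone (deriv U)
  deriv_zero : deriv U x₀ = 0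
  zero : U x₀ = 0
  growth : ∀ x, c / 2 * (x - x₀) ^ 2 ≤ U x

namespace ConvexWell

variable {U d f : ℝ → ℝ} {x₀ c D a : ℝ}

lemma convexOn (h : ConvexWell U x₀ c) : ConvexOn ℝ univ U :=
  h.monotone.convexOn_univ_of_deriv h.differentiable

lemma nonneg (h : ConvexWell U x₀ c) (hc : 0 < c) (x : ℝ) : 0 ≤ U x :=
  le_trans (by positivity) (h.growth x)

lemma reflect (h : ConvexWell U x₀ c) : ConvexWell (fun x => U (-x)) (-x₀) c where
  differentiable := h.differentiable.comp differentiable_neg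
  monotone := by
    intro x y hxy
    rw [deriv_comp_neg, deriv_comp_neg]
    exact neg_le_neg (h.monotone (neg_le_neg hxy))
  deriv_zero := by rw [deriv_comp_neg, neg_neg, h.deriv_zero, neg_zero]
  zero := by rw [neg_neg, h.zero]
  growth x := by
    convert h.growth (-x) using 2
    ring

lemma continuous_exp (h : ConvexWell U x₀ c) : Continuous fun x => Real.exp (-U x) := by
  have := h.differentiable.continuous
  fun_prop

lemma exp_neg_le (h : ConvexWell U x₀ c) (x : ℝ) :
    Real.exp (-U x) ≤ Real.exp (-(c / 2) * (x - x₀) ^ 2) :=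
  Real.exp_le_exp.2 (by linarith [h.growth x])

lemma integrable_gaussian (hc : 0 < c) (x₀ : ℝ) :
    Integrable fun x => Real.exp (-(c / 2) * (x - x₀) ^ 2) :=
  (integrable_exp_neg_mul_sq (half_pos hc)).comp_sub_right x₀

lemma integrable (h : ConvexWell U x₀ c) (hc : 0 < c) : Integrable fun x => Real.exp (-U x) := by
  refine (integrable_gaussian hc x₀).mono' h.continuous_exp.aestronglyMeasurable
    (ae_of_all _ fun x => ?_)
  rw [Real.norm_of_nonneg (Real.exp_pos _).le]
  exact h.exp_neg_le x

lemma partition_pos (h : ConvexWell U x₀ c) (hc : 0 < c) : 0 < ∫ x, Real.exp (-U x) :=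
  integral_exp_pos (h.integrable hc)

lemma partition_le (h : ConvexWell U x₀ c) (hc : 0 < c) :
    ∫ x, Real.exp (-U x) ≤ √(Real.pi / (c / 2)) := by
  rw [← integral_gaussian (c / 2), ← integral_sub_right_eq_self (fun x => Real.exp (-(c / 2) * x ^ 2)) x₀]
  exact integral_mono (h.integrable hc) (integrable_gaussian hc x₀) h.exp_neg_le

/-- By convexity `exp (-U)` is at least `exp (-U y)` on the segment from the minimum `x₀` to `y`.
That segment has length `2 Z`, so `2 Z exp (-U y) ≤ Z`. -/
lemma exp_le_half (h : ConvexWell U x₀ c) (hc : 0 < c) {y : ℝ}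
    (hy : |y - x₀| = 2 * ∫ x, Real.exp (-U x)) : Real.exp (-U y) ≤ 1 / 2 := by
  set Z := ∫ x, Real.exp (-U x) with hZ
  have hZ0 : 0 < Z := h.partition_pos hc
  have h1 : ∫ _ in uIcc x₀ y, Real.exp (-U y) ≤ ∫ x in uIcc x₀ y, Real.exp (-U x) := by
    refine setIntegral_mono_on ?_ (h.integrable hc).integrableOn measurableSet_uIcc fun x hx => ?_
    · exact integrableOn_const (by rw [uIcc]; simp)
    · refine Real.exp_le_exp.2 (neg_le_neg ?_)
      rw [← segment_eq_uIcc] at hx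
      have := h.convexOn.le_max_of_mem_segment (mem_univ _) (mem_univ _) hx
      rwa [h.zero, max_eq_right (h.nonneg hc y)] at this
  have h2 : ∫ x in uIcc x₀ y, Real.exp (-U x) ≤ Z :=
    setIntegral_le_integral (h.integrable hc) (ae_of_all _ fun x => (Real.exp_pos _).le)
  rw [setIntegral_const, Measure.real, Real.volume_interval, hy,
    ENNReal.toReal_ofReal (by positivity), smul_eq_mul] at h1
  have h3 := h1.trans h2
  rw [le_div_iff₀ two_pos]
  nlinarith

/-- Convex wells decay exponentially on the scale of their partition function. -/
lemma exp_neg_le_exp_abs (h : ConvexWell U x₀ c) (hc : 0 < c) (x : ℝ) :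
    Real.exp (-U x) ≤ 2 * Real.exp (-(|x - x₀| / (4 * ∫ x, Real.exp (-U x)))) := by
  set Z := ∫ x, Real.exp (-U x) with hZ
  have hZ0 : 0 < Z := h.partition_pos hc
  have hlog := Real.log_two_gt_d9
  have h2 : (2 : ℝ) = Real.exp (Real.log 2) := (Real.exp_log two_pos).symm
  rw [h2, ← Real.exp_add]
  refine Real.exp_le_exp.2 ?_
  rcases le_or_gt (|x - x₀|) (2 * Z) with hx | hx
  · have h3 : |x - x₀| / (4 * Z) ≤ 1 / 2 := by
      rw [div_le_iff₀ (by positivity)]; linarith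
    linarith [h.nonneg hc x]
  -- The point `(1 - θ) x₀ + θ x` lies at distance `2 Z` from `x₀`, where `U ≥ log 2`. Convexity
  -- with `U x₀ = 0` then gives `U x ≥ log 2 / θ`, which is linear in `|x - x₀|`.
  · set θ := 2 * Z / |x - x₀| with hθ
    have hax : 0 < |x - x₀| := by linarith
    have hθ0 : 0 < θ := by positivity
    have hθ1 : θ ≤ 1 := by rw [hθ, div_le_one hax]; exact hx.le
    have h4 : Real.exp (-U ((1 - θ) * x₀ + θ * x)) ≤ 1 / 2 := by
      refine h.exp_le_half hc ?_
      rw [show (1 - θ) * x₀ + θ * x - x₀ = θ * (x - x₀) by ring, abs_mul, abs_of_pos hθ0, hθ,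
        div_mul_cancel₀ _ hax.ne']
    have h5 := h.convexOn.2 (mem_univ x₀) (mem_univ x) (by linarith : 0 ≤ 1 - θ) hθ0.le (by ring)
    simp only [smul_eq_mul, h.zero, mul_zero, zero_add] at h5
    have h6 : Real.log 2 ≤ U ((1 - θ) * x₀ + θ * x) := by
      have := (Real.le_log_iff_exp_le (by norm_num)).2 h4
      rw [one_div, Real.log_inv] at this
      linarith
    have h7 : Real.log 2 ≤ 2 * Z * U x / |x - x₀| := by
      refine (h6.trans h5).trans (le_of_eq ?_)
      rw [hθ]; ring
    rw [le_div_iff₀ hax] at h7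
    have h8 : |x - x₀| / (4 * Z) ≤ U x := by
      rw [div_le_iff₀ (by positivity)]
      nlinarith
    linarith

/-- The constant is `2304 = 48 ^ 2`: with `s = |x - x₀| / (48 Z)` the exponential rate is `12 s`,
and `exp (12 s) = (exp s ^ 2) ^ 6 ≥ (1 + s ^ 2) ^ 6`. -/
lemma exp_neg_le_envelope (h : ConvexWell U x₀ c) (hc : 0 < c) (x : ℝ) :
    Real.exp (-U x) ≤ 2 * envelope (1 / 2304) ((x - x₀) / ∫ x, Real.exp (-U x)) := by
  refine (h.exp_neg_le_exp_abs hc x).trans (mul_le_mul_of_nonneg_left ?_ two_pos.le)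
  set Z := ∫ x, Real.exp (-U x) with hZ
  have hZ0 : 0 < Z := h.partition_pos hc
  set s := |x - x₀| / Z / 48 with hs
  have hs0 : 0 ≤ s := by positivity
  have e1 : 1 / 2304 * ((x - x₀) / Z) ^ 2 = s ^ 2 := by
    rw [hs, div_pow, div_pow, div_pow, sq_abs]; ring
  have e2 : |x - x₀| / (4 * Z) = 12 * s := by rw [hs]; field_simp; ring
  rw [envelope, e1, e2, Real.exp_neg]
  refine inv_anti₀ (by positivity) ?_
  have h1 : 1 + s ^ 2 ≤ Real.exp s ^ 2 := by
    have := pow_le_pow_left₀ (by positivity) (Real.add_one_le_exp s) 2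
    nlinarith
  calc (1 + s ^ 2) ^ 6 ≤ (Real.exp s ^ 2) ^ 6 := pow_le_pow_left₀ (by positivity) h1 6
    _ = Real.exp (12 * s) := by rw [← pow_mul, ← Real.exp_nat_mul]; norm_num

/-- Absolute moments of the envelope. -/
noncomputable def envelopeMoment (k : ℕ) : ℝ := ∫ t, |t| ^ k * (2 * envelope (1 / 2304) t)

lemma integrable_envelopeMoment {k : ℕ} (hk : k ≤ 10) :
    Integrable fun t : ℝ => |t| ^ k * (2 * envelope (1 / 2304) t) := by
  have := (integrable_abs_pow_mul_envelope (c := 1 / 2304) (by norm_num) (by norm_num) hk).const_mul 2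
  refine this.congr (ae_of_all _ fun x => ?_)
  ring

lemma envelopeMoment_nonneg (k : ℕ) : 0 ≤ envelopeMoment k :=
  integral_nonneg fun x => mul_nonneg (by positivity)
    (mul_nonneg two_pos.le (envelope_nonneg (by norm_num) x))

lemma integrable_moment (h : ConvexWell U x₀ c) (hc : 0 < c) {k : ℕ} (hk : k ≤ 10) :
    Integrable fun x => |x - x₀| ^ k * Real.exp (-U x) := by
  set Z := ∫ x, Real.exp (-U x) with hZ
  have hZ0 : 0 < Z := h.partition_pos hc
  have h1 := (((integrable_envelopeMoment hk).comp_div hZ0.ne').comp_sub_right x₀).const_mul (Z ^ k)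
  refine h1.mono' ?_ (ae_of_all _ fun x => ?_)
  · have := h.continuous_exp
    exact Continuous.aestronglyMeasurable (by fun_prop)
  · rw [Real.norm_of_nonneg (by positivity)]
    have := mul_le_mul_of_nonneg_left (h.exp_neg_le_envelope hc x)
      (by positivity : 0 ≤ |x - x₀| ^ k)
    rw [← hZ] at this
    refine this.trans (le_of_eq ?_)
    rw [abs_div, abs_of_pos hZ0, div_pow]
    field_simp

lemma moment_le (h : ConvexWell U x₀ c) (hc : 0 < c) {k : ℕ} (hk : k ≤ 10) :
    ∫ x, |x - x₀| ^ k * Real.exp (-U x) ≤ envelopeMoment k * (∫ x, Real.exp (-U x)) ^ (k + 1) := by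
  set Z := ∫ x, Real.exp (-U x) with hZ
  have hZ0 : 0 < Z := h.partition_pos hc
  have h1 := (((integrable_envelopeMoment hk).comp_div hZ0.ne').comp_sub_right x₀).const_mul (Z ^ k)
  calc ∫ x, |x - x₀| ^ k * Real.exp (-U x)
      ≤ ∫ x, Z ^ k * (|(x - x₀) / Z| ^ k * (2 * envelope (1 / 2304) ((x - x₀) / Z))) := by
        refine integral_mono (h.integrable_moment hc hk) h1 fun x => ?_
        have := mul_le_mul_of_nonneg_left (h.exp_neg_le_envelope hc x)
          (by positivity : 0 ≤ |x - x₀| ^ k)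
        rw [← hZ] at this
        refine this.trans (le_of_eq ?_)
        rw [abs_div, abs_of_pos hZ0, div_pow]
        field_simp
    _ = _ := by
        rw [integral_const_mul, integral_sub_right_eq_self
          (fun x => |x / Z| ^ k * (2 * envelope (1 / 2304) (x / Z))) x₀,
          Measure.integral_comp_div (fun t => |t| ^ k * (2 * envelope (1 / 2304) t)) Z,
          abs_of_pos hZ0, smul_eq_mul, envelopeMoment]
        ring

lemma hasDerivAt_exp (h : ConvexWell U x₀ c) (x : ℝ) :
    HasDerivAt (fun x => Real.exp (-U x)) (-deriv U x * Real.exp (-U x)) x := by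
  have := (h.differentiable x).hasDerivAt.neg.exp
  rwa [mul_comm] at this

lemma tendsto_exp (h : ConvexWell U x₀ c) (hc : 0 < c) :
    Filter.Tendsto (fun x => Real.exp (-U x)) Filter.atTop (nhds 0) := by
  refine Real.tendsto_exp_comp_nhds_zero.2 (Filter.tendsto_neg_atTop_atBot.comp ?_)
  refine Filter.tendsto_atTop_mono h.growth ?_
  refine Filter.Tendsto.const_mul_atTop (by positivity) ?_
  exact (Filter.tendsto_pow_atTop two_ne_zero).comp (Filter.tendsto_atTop_add_const_right _ _
    Filter.tendsto_id)

lemma abs_deriv_Ioi (h : ConvexWell U x₀ c) (hc : 0 < c) :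
    IntegrableOn (fun x => |deriv U x| * Real.exp (-U x)) (Ioi x₀) ∧
      ∫ x in Ioi x₀, |deriv U x| * Real.exp (-U x) = 1 := by
  have hs : ∀ x ∈ Ioi x₀, -deriv U x * Real.exp (-U x) ≤ 0 := fun x hx => by
    have : 0 ≤ deriv U x := h.deriv_zero ▸ h.monotone (mem_Ioi.1 hx).le
    nlinarith [Real.exp_pos (-U x)]
  have hcongr : EqOn (fun x => -(-deriv U x * Real.exp (-U x)))
      (fun x => |deriv U x| * Real.exp (-U x)) (Ioi x₀) := fun x hx => by
    have : 0 ≤ deriv U x := h.deriv_zero ▸ h.monotone (mem_Ioi.1 hx).le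
    simp only [abs_of_nonneg this]
    ring
  have h1 := integrableOn_Ioi_deriv_of_nonpos' (a := x₀) (fun x _ => h.hasDerivAt_exp x) hs
    (h.tendsto_exp hc)
  have h2 := integral_Ioi_of_hasDerivAt_of_nonpos' (a := x₀) (fun x _ => h.hasDerivAt_exp x) hs
    (h.tendsto_exp hc)
  refine ⟨(integrableOn_congr_fun hcongr measurableSet_Ioi).1 h1.neg, ?_⟩
  rw [← setIntegral_congr_fun measurableSet_Ioi hcongr, integral_neg, h2, h.zero]
  simp

/-- The value is the total variation of the unimodal function `exp (-U)`, which rises from `0` to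
`1` and falls back to `0`. It does not depend on the well, whence a uniform decay bound for
characteristic functions. -/
lemma abs_deriv (h : ConvexWell U x₀ c) (hc : 0 < c) :
    Integrable (fun x => |deriv U x| * Real.exp (-U x)) ∧
      ∫ x, |deriv U x| * Real.exp (-U x) = 2 := by
  obtain ⟨h1, h2⟩ := h.abs_deriv_Ioi hc
  obtain ⟨h3, h4⟩ := h.reflect.abs_deriv_Ioi hc
  simp only [deriv_comp_neg, abs_neg] at h3 h4
  have h5 : IntegrableOn (fun x => |deriv U x| * Real.exp (-U x)) (Iio x₀) := by
    have := (Measure.measurePreserving_neg (volume : Measure ℝ)).integrableOn_comp_preimage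
      (Homeomorph.neg ℝ).measurableEmbedding (f := fun x => |deriv U x| * Real.exp (-U x))
      (s := Iio x₀)
    have hset : Neg.neg ⁻¹' Iio x₀ = Ioi (-x₀) := by
      ext x
      simp only [mem_preimage, mem_Iio, mem_Ioi]
      exact neg_lt
    rw [← this, hset]
    exact h3
  have h5' : IntegrableOn (fun x => |deriv U x| * Real.exp (-U x)) (Iic x₀) :=
    (integrableOn_Iic_iff_integrableOn_Iio enorm_ne_top).2 h5
  have h6 : ∫ x in Iic x₀, |deriv U x| * Real.exp (-U x) = 1 := by
    have := integral_comp_neg_Ioi (-x₀) (fun x => |deriv U x| * Real.exp (-U x))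
    rw [neg_neg] at this
    rw [← this, h4]
  have h7 : IntegrableOn (fun x => |deriv U x| * Real.exp (-U x)) univ := by
    rw [← Iic_union_Ioi (a := x₀)]
    exact h5'.union h1
  refine ⟨integrableOn_univ.1 h7, ?_⟩
  rw [← setIntegral_univ, ← Iic_union_Ioi (a := x₀),
    setIntegral_union (Iic_disjoint_Ioi le_rfl) measurableSet_Ioi h5' h1, h6, h2]
  norm_num

end ConvexWell
end CramerConvex

/-! ### Tilted laws of perturbed wells: moments, variance, characteristic function. -/

namespace CramerConvex

open MeasureTheory ProbabilityTheory Set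

/-- The exponent `f` is a constant minus a convex well minus a bounded Lipschitz perturbation. -/
structure PerturbedWell (f U d : ℝ → ℝ) (x₀ c D a : ℝ) : Prop where
  well : ConvexWell U x₀ c
  pos : 0 < c
  eq : ∀ x, f x = a - U x - d x
  differentiable : Differentiable ℝ d
  bound : ∀ x, |d x| ≤ D
  bound_deriv : ∀ x, |deriv d x| ≤ D

namespace PerturbedWell

variable {f U d : ℝ → ℝ} {x₀ c D a : ℝ}

lemma bound_nonneg (h : PerturbedWell f U d x₀ c D a) : 0 ≤ D := (abs_nonneg _).trans (h.bound 0)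

lemma hasDerivAt (h : PerturbedWell f U d x₀ c D a) (x : ℝ) :
    HasDerivAt f (-deriv U x - deriv d x) x := by
  have := ((h.well.differentiable x).hasDerivAt.const_sub a).sub (h.differentiable x).hasDerivAt
  rwa [show f = fun x => a - U x - d x from funext h.eq]

lemma continuous (h : PerturbedWell f U d x₀ c D a) : Continuous f :=
  continuous_iff_continuousAt.2 fun x => (h.hasDerivAt x).continuousAt

lemma exp_le (h : PerturbedWell f U d x₀ c D a) (x : ℝ) :
    Real.exp (f x) ≤ Real.exp (a + D) * Real.exp (-U x) := by
  rw [← Real.exp_add, h.eq]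
  exact Real.exp_le_exp.2 (by linarith [neg_le_of_abs_le (h.bound x)])

lemma le_exp (h : PerturbedWell f U d x₀ c D a) (x : ℝ) :
    Real.exp (a - D) * Real.exp (-U x) ≤ Real.exp (f x) := by
  rw [← Real.exp_add, h.eq]
  exact Real.exp_le_exp.2 (by linarith [le_of_abs_le (h.bound x)])

lemma integrable_exp (h : PerturbedWell f U d x₀ c D a) : Integrable fun x => Real.exp (f x) := by
  refine ((h.well.integrable h.pos).const_mul (Real.exp (a + D))).mono' ?_ (ae_of_all _ fun x => ?_)
  · exact (Real.continuous_exp.comp h.continuous).aestronglyMeasurable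
  · rw [Real.norm_of_nonneg (Real.exp_pos _).le]
    exact h.exp_le x

lemma isProbabilityMeasure (h : PerturbedWell f U d x₀ c D a) :
    IsProbabilityMeasure ((volume : Measure ℝ).tilted f) :=
  isProbabilityMeasure_tilted h.integrable_exp

lemma integral_pos (h : PerturbedWell f U d x₀ c D a) : 0 < ∫ x, Real.exp (f x) :=
  integral_exp_pos h.integrable_exp

/-- The constant `a` cancels on normalization, and the perturbation costs a factor `exp D` in the
numerator and another in the denominator. -/
lemma density_le (h : PerturbedWell f U d x₀ c D a) (x : ℝ) :
    Real.exp (f x) / (∫ x, Real.exp (f x)) ≤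
      Real.exp (2 * D) / (∫ x, Real.exp (-U x)) * Real.exp (-U x) := by
  have hZ := h.well.partition_pos h.pos
  have h1 : Real.exp (a - D) * ∫ x, Real.exp (-U x) ≤ ∫ x, Real.exp (f x) := by
    rw [← integral_const_mul]
    exact integral_mono ((h.well.integrable h.pos).const_mul _) h.integrable_exp h.le_exp
  calc Real.exp (f x) / (∫ x, Real.exp (f x))
      ≤ (Real.exp (a + D) * Real.exp (-U x)) / (Real.exp (a - D) * ∫ x, Real.exp (-U x)) := by
        gcongr
        exact h.exp_le x
    _ = _ := by
        rw [show a + D = (a - D) + 2 * D by ring, Real.exp_add]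
        field_simp

lemma integral_tilted_le (h : PerturbedWell f U d x₀ c D a) {g : ℝ → ℝ}
    (hg : AEStronglyMeasurable g) (hg0 : ∀ x, 0 ≤ g x)
    (hi : Integrable fun x => g x * Real.exp (-U x)) :
    Integrable g ((volume : Measure ℝ).tilted f) ∧ ∫ x, g x ∂((volume : Measure ℝ).tilted f) ≤
      Real.exp (2 * D) / (∫ x, Real.exp (-U x)) * ∫ x, g x * Real.exp (-U x) := by
  have hc : AEStronglyMeasurable (fun x => Real.exp (f x) / ∫ x, Real.exp (f x)) volume :=
    ((Real.continuous_exp.comp h.continuous).div_const _).aestronglyMeasurable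
  have hbd (x : ℝ) : Real.exp (f x) / (∫ x, Real.exp (f x)) * g x ≤
      Real.exp (2 * D) / (∫ x, Real.exp (-U x)) * (g x * Real.exp (-U x)) := by
    refine (mul_le_mul_of_nonneg_right (h.density_le x) (hg0 x)).trans (le_of_eq ?_)
    ring
  have hpos := h.integral_pos
  have h1 : Integrable fun x => Real.exp (f x) / (∫ x, Real.exp (f x)) * g x := by
    refine (hi.const_mul (Real.exp (2 * D) / ∫ x, Real.exp (-U x))).mono'
      (hc.mul hg) (ae_of_all _ fun x => ?_)
    rw [Real.norm_of_nonneg (mul_nonneg (by positivity) (hg0 x))]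
    exact hbd x
  constructor
  · rw [integrable_tilted_iff h.integrable_exp]
    refine (h1.const_mul (∫ x, Real.exp (f x))).congr (ae_of_all _ fun x => ?_)
    simp only [smul_eq_mul]
    field_simp
  · rw [integral_tilted, ← integral_const_mul]
    exact integral_mono h1 (hi.const_mul _) hbd

lemma moment_le (h : PerturbedWell f U d x₀ c D a) {k : ℕ} (hk : k ≤ 10) :
    Integrable (fun x => |x - x₀| ^ k) ((volume : Measure ℝ).tilted f) ∧
    ∫ x, |x - x₀| ^ k ∂((volume : Measure ℝ).tilted f) ≤
      Real.exp (2 * D) * ConvexWell.envelopeMoment k * (∫ x, Real.exp (-U x)) ^ k := by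
  have hZ := h.well.partition_pos h.pos
  obtain ⟨h1, h2⟩ := h.integral_tilted_le (g := fun x => |x - x₀| ^ k) (by fun_prop)
    (fun x => by positivity) (h.well.integrable_moment h.pos hk)
  refine ⟨h1, h2.trans ?_⟩
  calc _ ≤ Real.exp (2 * D) / (∫ x, Real.exp (-U x)) *
        (ConvexWell.envelopeMoment k * (∫ x, Real.exp (-U x)) ^ (k + 1)) := by
        gcongr
        exact h.well.moment_le h.pos hk
    _ = _ := by
        rw [pow_succ]
        field_simp

lemma integrable_pow (h : PerturbedWell f U d x₀ c D a) {k : ℕ} (hk : k ≤ 10) (m : ℝ) :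
    Integrable (fun x => (x - m) ^ k) ((volume : Measure ℝ).tilted f) := by
  have := h.isProbabilityMeasure
  refine (((h.moment_le hk).1.add (integrable_const (|m - x₀| ^ k))).const_mul
    (2 ^ (k - 1))).mono' (by fun_prop) (ae_of_all _ fun x => ?_)
  rw [norm_pow, Real.norm_eq_abs]
  calc |x - m| ^ k ≤ (|x - x₀| + |m - x₀|) ^ k := by
        gcongr
        rw [abs_sub_comm m]
        exact abs_sub_le x x₀ m
    _ ≤ _ := add_pow_le (abs_nonneg _) (abs_nonneg _) k

lemma abs_mean_sub_le (h : PerturbedWell f U d x₀ c D a) :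
    |(∫ x, x ∂((volume : Measure ℝ).tilted f)) - x₀| ≤
      Real.exp (2 * D) * ConvexWell.envelopeMoment 1 * ∫ x, Real.exp (-U x) := by
  have := h.isProbabilityMeasure
  obtain ⟨h1, h2⟩ := h.moment_le (k := 1) (by norm_num)
  simp only [pow_one] at h1 h2
  refine le_trans ?_ h2
  have hi := h.integrable_pow (k := 1) (by norm_num) 0
  simp only [pow_one, sub_zero] at hi
  have : (∫ x, x ∂((volume : Measure ℝ).tilted f)) - x₀ =
      ∫ x, (x - x₀) ∂((volume : Measure ℝ).tilted f) := by
    rw [integral_sub hi (integrable_const _)]; simp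
  rw [this, ← Real.norm_eq_abs]
  exact norm_integral_le_integral_norm _

lemma central_moment_le (h : PerturbedWell f U d x₀ c D a) {k : ℕ} (hk : k ≤ 10) {m R : ℝ}
    (hm : |m - x₀| ≤ R) :
    ∫ x, |x - m| ^ k ∂((volume : Measure ℝ).tilted f) ≤ 2 ^ (k - 1) * (Real.exp (2 * D) *
      ConvexWell.envelopeMoment k * (∫ x, Real.exp (-U x)) ^ k + R ^ k) := by
  have := h.isProbabilityMeasure
  obtain ⟨h1, h2⟩ := h.moment_le hk
  calc ∫ x, |x - m| ^ k ∂((volume : Measure ℝ).tilted f)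
      ≤ ∫ x, 2 ^ (k - 1) * (|x - x₀| ^ k + R ^ k) ∂((volume : Measure ℝ).tilted f) := by
        refine integral_mono ?_ ((h1.add (integrable_const _)).const_mul _) fun x => ?_
        · simpa [abs_pow] using (h.integrable_pow hk m).abs
        · calc |x - m| ^ k ≤ (|x - x₀| + R) ^ k := by
                gcongr
                rw [abs_sub_comm m] at hm
                exact (abs_sub_le x x₀ m).trans (by linarith)
            _ ≤ _ := add_pow_le (abs_nonneg _) ((abs_nonneg _).trans hm) k
    _ = 2 ^ (k - 1) * (∫ x, |x - x₀| ^ k ∂((volume : Measure ℝ).tilted f) + R ^ k) := by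
        rw [integral_const_mul, integral_add h1 (integrable_const _)]
        simp
    _ ≤ _ := by gcongr

/-- A law with bounded density is not concentrated. -/
lemma le_variance (h : PerturbedWell f U d x₀ c D a) (m : ℝ) :
    (∫ x, Real.exp (-U x)) ^ 2 / (32 * Real.exp (4 * D)) ≤
      ∫ x, (x - m) ^ 2 ∂((volume : Measure ℝ).tilted f) := by
  have := h.isProbabilityMeasure
  have hZ := h.well.partition_pos h.pos
  set Z := ∫ x, Real.exp (-U x) with hZdef
  -- The density is at most `exp (2 * D) / Z`, so the interval of radius `t` about `m` carries mass
  -- at most `1/2`. The remaining mass lies at distance at least `t`, and the second moment is at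
  -- least `t ^ 2 / 2`.
  set t := Z / (4 * Real.exp (2 * D)) with ht
  have ht0 : 0 < t := by positivity
  set S := Icc (m - t) (m + t)
  have hmeas : Measurable (S.indicator fun _ => (1 : ℝ)) :=
    measurable_const.indicator measurableSet_Icc
  have hle (x : ℝ) : S.indicator (fun _ => (1 : ℝ)) x * Real.exp (-U x) ≤ S.indicator (fun _ => 1) x := by
    refine mul_le_of_le_one_right (indicator_nonneg (fun _ _ => zero_le_one) x) ?_
    exact Real.exp_le_one_iff.2 (neg_nonpos.2 (h.well.nonneg h.pos x))
  have hSi : Integrable (S.indicator fun _ => (1 : ℝ)) :=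
    (integrableOn_const (by simp [S])).integrable_indicator measurableSet_Icc
  have hi : Integrable fun x => S.indicator (fun _ => (1 : ℝ)) x * Real.exp (-U x) := by
    refine hSi.mono' (hmeas.aestronglyMeasurable.mul h.well.continuous_exp.aestronglyMeasurable)
      (ae_of_all _ fun x => ?_)
    rw [Real.norm_of_nonneg (mul_nonneg (indicator_nonneg (fun _ _ => zero_le_one) x)
      (Real.exp_pos _).le)]
    exact hle x
  obtain ⟨h1, h2⟩ := h.integral_tilted_le hmeas.aestronglyMeasurable
    (fun x => indicator_nonneg (fun _ _ => zero_le_one) x) hi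
  have h3 : ∫ x, S.indicator (fun _ => (1 : ℝ)) x * Real.exp (-U x) ≤ 2 * t := by
    refine (integral_mono hi hSi hle).trans (le_of_eq ?_)
    rw [integral_indicator measurableSet_Icc, setIntegral_const, Measure.real, Real.volume_Icc,
      ENNReal.toReal_ofReal (by linarith), smul_eq_mul]
    ring
  have h4 : ∫ x, S.indicator (fun _ => (1 : ℝ)) x ∂((volume : Measure ℝ).tilted f) ≤ 1 / 2 := by
    refine h2.trans ?_
    calc _ ≤ Real.exp (2 * D) / Z * (2 * t) := by gcongr
      _ = 1 / 2 := by rw [ht]; field_simp; norm_num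
  have h5 : ∫ x, (t ^ 2 - t ^ 2 * S.indicator (fun _ => (1 : ℝ)) x) ∂((volume : Measure ℝ).tilted f)
      ≤ ∫ x, (x - m) ^ 2 ∂((volume : Measure ℝ).tilted f) := by
    refine integral_mono ((integrable_const _).sub (h1.const_mul _))
      (h.integrable_pow (by norm_num) m) fun x => ?_
    by_cases hx : x ∈ S
    · simp only [indicator_of_mem hx]
      nlinarith [sq_nonneg (x - m)]
    · simp only [indicator_of_notMem hx, mul_zero, sub_zero]
      rw [← sq_abs (x - m)]
      refine pow_le_pow_left₀ ht0.le ?_ 2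
      by_contra hcon
      push Not at hcon
      rw [abs_lt] at hcon
      exact hx ⟨by linarith, by linarith⟩
  rw [integral_sub (integrable_const _) (h1.const_mul _), integral_const_mul, integral_const] at h5
  simp only [probReal_univ, smul_eq_mul, one_mul] at h5
  have h6 : t ^ 2 / 2 = Z ^ 2 / (32 * Real.exp (4 * D)) := by
    rw [ht, show 4 * D = 2 * D + 2 * D by ring, Real.exp_add]
    field_simp
    norm_num
  nlinarith [sq_nonneg t]

/-- One integration by parts bounds the characteristic function by the `L¹` norm of the density's
derivative over `|u|`. The part from `deriv U` is controlled by `ConvexWell.abs_deriv`, the part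
from `deriv d` by `D`. -/
lemma norm_charFun_le (h : PerturbedWell f U d x₀ c D a) {u : ℝ} (hu : u ≠ 0) :
    ‖charFun ((volume : Measure ℝ).tilted f) u‖ ≤
      Real.exp (2 * D) * (2 / (∫ x, Real.exp (-U x)) + D) / |u| := by
  have hprob := h.isProbabilityMeasure
  have hZ := h.well.partition_pos h.pos
  have hN := h.integral_pos
  have hD := h.bound_nonneg
  obtain ⟨t1, t2⟩ := h.well.abs_deriv h.pos
  set Z := ∫ x, Real.exp (-U x) with hZdef
  set N := ∫ x, Real.exp (f x) with hNdef
  set p' : ℝ → ℝ := fun x => (-deriv U x - deriv d x) * (Real.exp (f x) / N) with hp'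
  have hp (x : ℝ) : HasDerivAt (fun x => Real.exp (f x) / N) (p' x) x := by
    have := (h.hasDerivAt x).exp.div_const N
    rwa [show p' x = Real.exp (f x) * (-deriv U x - deriv d x) / N by rw [hp']; ring]
  set B : ℝ → ℝ := fun x => Real.exp (2 * D) / Z *
    (|deriv U x| * Real.exp (-U x) + D * Real.exp (-U x)) with hB
  have hBi : Integrable B := (t1.add ((h.well.integrable h.pos).const_mul D)).const_mul _
  have hBint : ∫ x, B x = Real.exp (2 * D) * (2 / Z + D) := by
    rw [hB, integral_const_mul, integral_add t1 ((h.well.integrable h.pos).const_mul D), t2,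
      integral_const_mul, ← hZdef]
    field_simp
  have hp'B (x : ℝ) : |p' x| ≤ B x := by
    rw [hp', hB, abs_mul, abs_of_pos (by positivity : 0 < Real.exp (f x) / N)]
    have e1 : |-deriv U x - deriv d x| ≤ |deriv U x| + D := by
      refine (abs_sub _ _).trans ?_
      rw [abs_neg]
      linarith [h.bound_deriv x]
    calc _ ≤ (|deriv U x| + D) * (Real.exp (2 * D) / Z * Real.exp (-U x)) := by
          gcongr
          exact h.density_le x
      _ = _ := by ring
  have hp'm : Measurable p' := by
    have := h.continuous.measurable
    have := measurable_deriv U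
    have := measurable_deriv d
    fun_prop
  set v : ℝ → ℂ := fun x => Complex.exp (u * x * Complex.I) / (u * Complex.I) with hv
  have huI : (u * Complex.I : ℂ) ≠ 0 := mul_ne_zero (by exact_mod_cast hu) Complex.I_ne_zero
  have hvd (x : ℝ) : HasDerivAt v (Complex.exp (u * x * Complex.I)) x := by
    have := ((((hasDerivAt_id x).ofReal_comp).const_mul (u : ℂ)).mul_const Complex.I).cexp.div_const
      (u * Complex.I : ℂ)
    refine this.congr_deriv ?_
    simp only [id_eq, Complex.ofReal_one, mul_one]
    rw [mul_div_cancel_right₀ _ huI]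
  have hvn (x : ℝ) : ‖v x‖ = 1 / |u| := by
    change ‖Complex.exp (u * x * Complex.I) / (u * Complex.I)‖ = _
    rw [norm_div, ← Complex.ofReal_mul, Complex.norm_exp_ofReal_mul_I, norm_mul, Complex.norm_I,
      mul_one, Complex.norm_real, Real.norm_eq_abs]
  have hvc : Continuous v := by rw [hv]; fun_prop
  have hec : Continuous fun x : ℝ => Complex.exp (u * x * Complex.I) := by fun_prop
  have hpi : Integrable fun x => ((Real.exp (f x) / N : ℝ) : ℂ) := (h.integrable_exp.div_const N).ofReal
  have i1 : Integrable fun x : ℝ => ((Real.exp (f x) / N : ℝ) : ℂ) * Complex.exp (u * x * Complex.I) := by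
    refine hpi.mul_bdd (c := 1) hec.aestronglyMeasurable (ae_of_all _ fun x => ?_)
    rw [← Complex.ofReal_mul, Complex.norm_exp_ofReal_mul_I]
  have i2 : Integrable fun x => ((p' x : ℝ) : ℂ) * v x := by
    have : Integrable p' := hBi.mono' hp'm.aestronglyMeasurable (ae_of_all _ hp'B)
    exact this.ofReal.mul_bdd (c := 1 / |u|) hvc.aestronglyMeasurable
      (ae_of_all _ fun x => (hvn x).le)
  have i3 : Integrable fun x => ((Real.exp (f x) / N : ℝ) : ℂ) * v x :=
    hpi.mul_bdd (c := 1 / |u|) hvc.aestronglyMeasurable (ae_of_all _ fun x => (hvn x).le)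
  have key := integral_mul_deriv_eq_deriv_mul_of_integrable (A := ℂ)
    (fun x _ => (hp x).ofReal_comp) (fun x _ => hvd x) i1 i2 i3
  have hchar : charFun ((volume : Measure ℝ).tilted f) u =
      ∫ x : ℝ, ((Real.exp (f x) / N : ℝ) : ℂ) * Complex.exp (u * x * Complex.I) := by
    rw [charFun_apply_real, integral_tilted]
    rfl
  rw [hchar, key, norm_neg]
  calc _ ≤ ∫ x, B x * (1 / |u|) := by
        refine norm_integral_le_of_norm_le (hBi.mul_const _) (ae_of_all _ fun x => ?_)
        rw [norm_mul, hvn, Complex.norm_real]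
        exact mul_le_mul_of_nonneg_right (hp'B x) (by positivity)
    _ = _ := by rw [integral_mul_const, hBint]; ring

end PerturbedWell
end CramerConvex

/-! ### Bounds uniform in the tilt. -/

namespace CramerConvex

open MeasureTheory ProbabilityTheory Set

/-- Uniform normalization: after centering and rescaling, the tilted laws attached to perturbed
wells satisfy moment and characteristic function bounds depending only on `c` and `D`. -/
theorem PerturbedWell.exists_normalized {c D : ℝ} (hD : 0 ≤ D) :
    ∃ M A S : ℝ, 0 ≤ M ∧ 1 ≤ A ∧ ∀ (f U d : ℝ → ℝ) (x₀ a : ℝ), PerturbedWell f U d x₀ c D a →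
      let μ := (volume : Measure ℝ).tilted f
      let m := ∫ x, x ∂μ
      let V := ∫ x, (x - m) ^ 2 ∂μ
      0 < V ∧ |m - x₀| ≤ S ∧ Normalized (μ.map fun x => (√V)⁻¹ * (x - m)) M A := by
  set e := Real.exp (2 * D) with he
  have he0 : 0 < e := Real.exp_pos _
  set L := ConvexWell.envelopeMoment with hL
  have hL0 := ConvexWell.envelopeMoment_nonneg
  set Zmax := √(Real.pi / (c / 2)) with hZm
  have hZm0 : 0 ≤ Zmax := Real.sqrt_nonneg _
  set R := e * L 1 with hR
  have hR0 : 0 ≤ R := mul_nonneg he0.le (hL0 1)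
  set M := 8 * (e * L 4 + R ^ 4) * (32 * e ^ 2) ^ 2 with hM
  set G := √(2 * (e * L 2 + R ^ 2)) with hG
  have hG0 : 0 ≤ G := Real.sqrt_nonneg _
  have hL4 := hL0 4
  have hL2 := hL0 2
  -- Mean displacement, standard deviation and fourth moment scale like `Z`, `Z` and `Z ^ 4`, so `Z`
  -- cancels from the normalized fourth moment. It survives in the term `D * Z` of the decay
  -- constant and in `|m - x₀| ≤ R * Z`, where the bound `Zmax`, depending only on `c`, replaces it.
  refine ⟨M, max 1 (G * e * (2 + D * Zmax)), R * Zmax, ?_, le_max_left _ _, ?_⟩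
  · rw [hM]; positivity
  intro f U d x₀ a h μ m V
  have hprob : IsProbabilityMeasure μ := h.isProbabilityMeasure
  have hZ := h.well.partition_pos h.pos
  have hZle := h.well.partition_le h.pos
  rw [← hZm] at hZle
  set Z := ∫ x, Real.exp (-U x) with hZdef
  have hm : |m - x₀| ≤ R * Z := h.abs_mean_sub_le
  have hV1 : Z ^ 2 / (32 * e ^ 2) ≤ V := by
    have := h.le_variance m
    rwa [show 4 * D = 2 * D + 2 * D by ring, Real.exp_add, ← sq] at this
  have hV0 : 0 < V := lt_of_lt_of_le (by positivity) hV1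
  set s := √V with hs
  have hs0 : 0 < s := Real.sqrt_pos.2 hV0
  have hs2 : s ^ 2 = V := Real.sq_sqrt hV0.le
  have hV2 : V ≤ 2 * (e * L 2 + R ^ 2) * Z ^ 2 := by
    have := h.central_moment_le (k := 2) (by norm_num) hm
    simp only [sq_abs] at this
    refine this.trans (le_of_eq ?_)
    norm_num
    ring
  have hsZ : s ≤ G * Z := by
    rw [hs, hG, ← Real.sqrt_sq hZ.le, ← Real.sqrt_mul (by positivity)]
    exact Real.sqrt_le_sqrt hV2
  have h4 : ∫ x, (x - m) ^ 4 ∂μ ≤ M * V ^ 2 := by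
    have h1 := h.central_moment_le (k := 4) (by norm_num) hm
    have h2 : ∫ x, (x - m) ^ 4 ∂μ = ∫ x, |x - m| ^ 4 ∂μ := by
      simp_rw [pow_abs]
      refine integral_congr_ae (ae_of_all _ fun x => ?_)
      simp only
      rw [abs_of_nonneg (by positivity)]
    rw [h2]
    refine h1.trans ?_
    have h3 : Z ^ 2 ≤ V * (32 * e ^ 2) := (div_le_iff₀ (by positivity)).1 hV1
    have h5 := pow_le_pow_left₀ (by positivity) h3 2
    calc _ = 8 * (e * L 4 + R ^ 4) * (Z ^ 2) ^ 2 := by norm_num; ring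
      _ ≤ 8 * (e * L 4 + R ^ 4) * (V * (32 * e ^ 2)) ^ 2 := by gcongr
      _ = _ := by rw [hM]; ring
  have hi (k : ℕ) (hk : k ≤ 10) : Integrable (fun x => (x - m) ^ k) μ := h.integrable_pow hk m
  have hmap (k : ℕ) : ∫ y, y ^ k ∂(μ.map fun x => s⁻¹ * (x - m)) =
      (s⁻¹) ^ k * ∫ x, (x - m) ^ k ∂μ := by
    rw [integral_map (by fun_prop) (by fun_prop), ← integral_const_mul]
    simp_rw [mul_pow]
  refine ⟨hV0, hm.trans (by gcongr), ?_, ?_, ?_, ?_, ?_⟩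
  · rw [integrable_map_measure (by fun_prop) (by fun_prop)]
    refine ((hi 4 (by norm_num)).const_mul ((s⁻¹) ^ 4)).congr (ae_of_all _ fun x => ?_)
    simp only [Function.comp, mul_pow]
  · have := hmap 1
    simp only [pow_one] at this
    have hx : Integrable (fun x => x) μ := by simpa using h.integrable_pow (k := 1) (by norm_num) 0
    rw [this, integral_sub hx (integrable_const _)]
    simp [m]
  · rw [hmap 2]
    change s⁻¹ ^ 2 * V = 1
    rw [← hs2]
    field_simp
  · rw [hmap 4]
    calc _ ≤ s⁻¹ ^ 4 * (M * V ^ 2) := by gcongr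
      _ = M := by rw [← hs2]; field_simp
  · intro u hu
    have hcf : ‖charFun (μ.map fun x => s⁻¹ * (x - m)) u‖ = ‖charFun μ (s⁻¹ * u)‖ := by
      rw [charFun_map_mul_comp (by fun_prop)]
      simp_rw [sub_eq_add_neg]
      rw [charFun_map_add_const, norm_mul, Complex.norm_exp_ofReal_mul_I, mul_one]
    rw [hcf]
    refine (h.norm_charFun_le (u := s⁻¹ * u) (by positivity)).trans ?_
    rw [abs_mul, abs_of_pos (inv_pos.2 hs0), ← div_div]
    refine div_le_div_of_nonneg_right (le_trans ?_ (le_max_right _ _)) (abs_nonneg u)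
    rw [div_inv_eq_mul]
    calc e * (2 / Z + D) * s ≤ e * (2 / Z + D) * (G * Z) := by gcongr
      _ = G * e * (2 + D * Z) := by field_simp
      _ ≤ _ := by gcongr

/-- Decomposition of the exponents `σ x - ψ x` of a perturbed strictly convex potential into
perturbed wells, uniformly in the tilt. -/
theorem PerturbedStrictlyConvex.exists_perturbedWell {ψ : ℝ → ℝ} (hψ : PerturbedStrictlyConvex ψ) :
    ∃ c D : ℝ, 0 < c ∧ 0 ≤ D ∧ ∃ g : ℝ → ℝ, ∃ d : ℝ → ℝ,
      (∀ σ, ∃ x₀, g x₀ = σ) ∧ ∀ x₀, ∃ (U : ℝ → ℝ) (a : ℝ),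
        PerturbedWell (fun x => g x₀ * x - ψ x) U d x₀ c D a := by
  obtain ⟨ψc, δψ, hsum, hd1, hd2, ⟨c, hc, hconv⟩, hδ, C, hC⟩ := hψ
  have hmono : Monotone fun x => deriv ψc x - c * x := by
    refine monotone_of_deriv_nonneg (hd2.sub (differentiable_id.const_mul c)) fun x => ?_
    rw [deriv_fun_sub (hd2 x) (by fun_prop)]
    simp
    exact hconv x
  have hcont : Continuous (deriv ψc) := hd2.continuous
  have hsurj : Function.Surjective (deriv ψc) := by
    refine hcont.surjective ?_ ?_
    · refine Filter.tendsto_atTop_mono' _ (f₁ := fun x => c * x + deriv ψc 0) ?_ ?_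
      · filter_upwards [Filter.eventually_ge_atTop 0] with x hx
        have := hmono hx
        simp only [mul_zero, sub_zero] at this
        linarith
      · exact Filter.tendsto_atTop_add_const_right _ _ (Filter.tendsto_id.const_mul_atTop hc)
    · refine Filter.tendsto_atBot_mono' _ (f₁ := fun x => c * x + deriv ψc 0) ?_ ?_
      · filter_upwards [Filter.eventually_le_atBot 0] with x hx
        have := hmono hx
        simp only [mul_zero, sub_zero] at this
        linarith
      · exact Filter.tendsto_atBot_add_const_right _ _ (Filter.tendsto_id.const_mul_atBot hc)
  -- Tilts are parametrized by the point `x₀` with `deriv ψc x₀ = σ`. The well is then `ψc` minus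
  -- its tangent at `x₀`, and the perturbation `δψ` is the same for all tilts.
  refine ⟨c, C, hc, ?_, deriv ψc, δψ, hsurj, fun x₀ => ?_⟩
  · exact le_trans (by positivity) (hC 0)
  set g := deriv ψc
  refine ⟨fun x => ψc x - ψc x₀ - g x₀ * (x - x₀), g x₀ * x₀ - ψc x₀, ?_, hc, ?_, hδ, ?_, ?_⟩
  · have hder (x : ℝ) : HasDerivAt (fun x => ψc x - ψc x₀ - g x₀ * (x - x₀)) (g x - g x₀) x := by
      have := ((hd1 x).hasDerivAt.sub_const (ψc x₀)).sub
        (((hasDerivAt_id x).sub_const x₀).const_mul (g x₀))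
      exact this.congr_deriv (by simp [g])
    have hderiv : deriv (fun x => ψc x - ψc x₀ - g x₀ * (x - x₀)) = fun x => g x - g x₀ :=
      funext fun x => (hder x).deriv
    refine ⟨fun x => (hder x).differentiableAt, ?_, ?_, by simp, ?_⟩
    · rw [hderiv]
      intro x y hxy
      have := hmono hxy
      simp only at this
      have h2 := mul_le_mul_of_nonneg_left hxy hc.le
      change g x - g x₀ ≤ g y - g x₀
      linarith
    · rw [hderiv]; simp
    · have hq (x : ℝ) : HasDerivAt (fun x => ψc x - ψc x₀ - g x₀ * (x - x₀) - c / 2 * (x - x₀) ^ 2)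
          (g x - g x₀ - c * (x - x₀)) x := by
        have := (hder x).sub ((((hasDerivAt_id x).sub_const x₀).pow 2).const_mul (c / 2))
        refine this.congr_deriv ?_
        simp
        ring
      have hqc : ConvexOn ℝ univ
          fun x => ψc x - ψc x₀ - g x₀ * (x - x₀) - c / 2 * (x - x₀) ^ 2 := by
        refine Monotone.convexOn_univ_of_deriv (fun x => (hq x).differentiableAt) ?_
        rw [funext fun x => (hq x).deriv]
        intro x y hxy
        have := hmono hxy
        simp only at this ⊢
        linarith
      intro x
      have hq0 : HasDerivAt (fun x => ψc x - ψc x₀ - g x₀ * (x - x₀) - c / 2 * (x - x₀) ^ 2) 0 x₀ := by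
        simpa using hq x₀
      rcases lt_trichotomy x x₀ with hx | rfl | hx
      · have := hqc.slope_le_of_hasDerivAt (mem_univ x) (mem_univ x₀) hx hq0
        rw [slope_def_field, div_le_iff₀ (by linarith)] at this
        simp at this
        linarith
      · simp
      · have := hqc.le_slope_of_hasDerivAt (mem_univ x₀) (mem_univ x) hx hq0
        rw [slope_def_field, le_div_iff₀ (by linarith)] at this
        simp at this
        linarith
  · intro x
    rw [hsum x]
    ring
  · intro x
    have := hC x
    linarith [abs_nonneg (deriv δψ x)]
  · intro x
    have := hC x
    linarith [abs_nonneg (δψ x)]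

end CramerConvex

/-! ### Legendre duality and the second derivative of the Cramér transform. -/

namespace CramerConvex

open MeasureTheory ProbabilityTheory Set

lemma contDiff_two_of_hasDerivAt {f f' f'' : ℝ → ℝ} (h1 : ∀ x, HasDerivAt f (f' x) x)
    (h2 : ∀ x, HasDerivAt f' (f'' x) x) (h3 : Continuous f'') :
    ContDiff ℝ 2 f ∧ iteratedDeriv 2 f = f'' := by
  have e1 : deriv f = f' := funext fun x => (h1 x).deriv
  have e2 : deriv f' = f'' := funext fun x => (h2 x).deriv
  constructor
  · rw [show (2 : WithTop ℕ∞) = 1 + 1 from rfl, contDiff_succ_iff_deriv, e1, contDiff_one_iff_deriv,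
      e2]
    exact ⟨fun x => (h1 x).differentiableAt, by simp, fun x => (h2 x).differentiableAt, h3⟩
  · rw [iteratedDeriv_succ, iteratedDeriv_one, e1, e2]

lemma tangent_le_of_monotone {f f' : ℝ → ℝ} (h : ∀ x, HasDerivAt f (f' x) x) (hf : Monotone f')
    (x y : ℝ) : f x + f' x * (y - x) ≤ f y := by
  have hc : ConvexOn ℝ univ f := Monotone.convexOn_univ_of_deriv
    (fun x => (h x).differentiableAt) (by rwa [funext fun x => (h x).deriv])
  rcases lt_trichotomy y x with hx | rfl | hx
  · have := hc.slope_le_of_hasDerivAt (mem_univ y) (mem_univ x) hx (h x)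
    rw [slope_def_field, div_le_iff₀ (by linarith)] at this
    linarith
  · simp
  · have := hc.le_slope_of_hasDerivAt (mem_univ x) (mem_univ y) hx (h x)
    rw [slope_def_field, le_div_iff₀ (by linarith)] at this
    linarith

section Legendre

variable {ψ : ℝ → ℝ}

lemma tiltedMeasure_eq_tilted (hint : ∀ σ, Integrable fun x => Real.exp (σ * x - ψ x)) (σ : ℝ) :
    tiltedMeasure ψ σ = (tiltedMeasure ψ 0).tilted (fun x => σ * id x) := by
  rw [tiltedMeasure, tiltedMeasure, tilted_tilted (hint 0)]
  congr 1
  funext x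
  simp
  ring

lemma integrableExpSet_tiltedMeasure (hint : ∀ σ, Integrable fun x => Real.exp (σ * x - ψ x)) :
    integrableExpSet id (tiltedMeasure ψ 0) = univ := by
  refine eq_univ_of_forall fun σ => ?_
  change Integrable _ _
  rw [tiltedMeasure, integrable_tilted_iff (hint 0)]
  refine (hint σ).congr (ae_of_all _ fun x => ?_)
  simp only [id_eq, smul_eq_mul]
  rw [← Real.exp_add]
  congr 1
  ring

/-- With the probability measure `tiltedMeasure ψ 0` as base, `φ*` is a cumulant generating function
up to an additive constant. This yields its analyticity and identifies its first two derivatives as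
mean and variance. -/
lemma logLaplace_eq_cgf (hint : ∀ σ, Integrable fun x => Real.exp (σ * x - ψ x)) :
    logLaplace ψ = fun σ => cgf id (tiltedMeasure ψ 0) σ + logLaplace ψ 0 := by
  funext σ
  rw [cgf, mgf, tiltedMeasure, integral_exp_tilted, logLaplace, logLaplace,
    Real.log_div (integral_exp_pos ?_).ne' (integral_exp_pos (hint 0)).ne', sub_add_cancel]
  · congr 2
    funext x
    simp
    ring_nf
  · refine (hint σ).congr (ae_of_all _ fun x => ?_)
    simp
    ring_nf

lemma hasDerivAt_logLaplace (hint : ∀ σ, Integrable fun x => Real.exp (σ * x - ψ x)) (σ : ℝ) :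
    HasDerivAt (logLaplace ψ) (tiltedMean ψ σ) σ := by
  have hσ : σ ∈ interior (integrableExpSet id (tiltedMeasure ψ 0)) := by
    rw [integrableExpSet_tiltedMeasure hint]; simp
  rw [logLaplace_eq_cgf hint, tiltedMean, tiltedMeasure_eq_tilted hint σ]
  have := integral_tilted_mul_self hσ
  simp only [id_eq] at this ⊢
  rw [this]
  exact ((analyticAt_cgf hσ).differentiableAt.hasDerivAt).add_const _

lemma tiltedMean_eq_deriv (hint : ∀ σ, Integrable fun x => Real.exp (σ * x - ψ x)) :
    tiltedMean ψ = deriv (cgf id (tiltedMeasure ψ 0)) := by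
  funext σ
  rw [← (hasDerivAt_logLaplace hint σ).deriv, logLaplace_eq_cgf hint, deriv_add_const]

lemma tiltedVariance_eq_deriv (hint : ∀ σ, Integrable fun x => Real.exp (σ * x - ψ x)) :
    tiltedVariance ψ = deriv (deriv (cgf id (tiltedMeasure ψ 0))) := by
  funext σ
  have hσ : σ ∈ interior (integrableExpSet id (tiltedMeasure ψ 0)) := by
    rw [integrableExpSet_tiltedMeasure hint]; simp
  have := variance_tilted_mul hσ
  rw [iteratedDeriv_succ, iteratedDeriv_one] at this
  rw [← this, variance_eq_integral aemeasurable_id, ← tiltedMeasure_eq_tilted hint, tiltedVariance]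
  rfl

lemma hasDerivAt_tiltedMean (hint : ∀ σ, Integrable fun x => Real.exp (σ * x - ψ x)) (σ : ℝ) :
    HasDerivAt (tiltedMean ψ) (tiltedVariance ψ σ) σ := by
  have hσ : σ ∈ interior (integrableExpSet id (tiltedMeasure ψ 0)) := by
    rw [integrableExpSet_tiltedMeasure hint]; simp
  rw [tiltedVariance_eq_deriv hint, tiltedMean_eq_deriv hint]
  exact (analyticAt_cgf hσ).deriv.differentiableAt.hasDerivAt

lemma continuous_tiltedVariance (hint : ∀ σ, Integrable fun x => Real.exp (σ * x - ψ x)) :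
    Continuous (tiltedVariance ψ) := by
  rw [tiltedVariance_eq_deriv hint]
  refine continuous_iff_continuousAt.2 fun σ => ?_
  have hσ : σ ∈ interior (integrableExpSet id (tiltedMeasure ψ 0)) := by
    rw [integrableExpSet_tiltedMeasure hint]; simp
  exact (analyticAt_cgf hσ).deriv.deriv.continuousAt

/-- The Cramér transform is the Legendre transform of a smooth strictly convex function. -/
theorem exists_tilt (hint : ∀ σ, Integrable fun x => Real.exp (σ * x - ψ x))
    (hvar : ∀ σ, 0 < tiltedVariance ψ σ) (hbot : ∀ m, ∃ σ, tiltedMean ψ σ ≤ m)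
    (htop : ∀ m, ∃ σ, m ≤ tiltedMean ψ σ) :
    ∃ s : ℝ → ℝ, (∀ m, tiltedMean ψ (s m) = m) ∧ (∀ σ, s (tiltedMean ψ σ) = σ) ∧
      ContDiff ℝ 2 (cramerTransform ψ) ∧
      ∀ m, iteratedDeriv 2 (cramerTransform ψ) m = (tiltedVariance ψ (s m))⁻¹ := by
  have hd := hasDerivAt_tiltedMean hint
  have hmono : StrictMono (tiltedMean ψ) := strictMono_of_deriv_pos fun σ => by
    rw [(hd σ).deriv]; exact hvar σ
  have hcont : Continuous (tiltedMean ψ) := continuous_iff_continuousAt.2 fun σ => (hd σ).continuousAt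
  have hsurj : Function.Surjective (tiltedMean ψ) := fun m => by
    obtain ⟨a, ha⟩ := hbot m
    obtain ⟨b, hb⟩ := htop m
    exact mem_range_of_exists_le_of_exists_ge hcont ⟨a, ha⟩ ⟨b, hb⟩
  set e := hmono.orderIsoOfSurjective _ hsurj with he
  have hes (m : ℝ) : tiltedMean ψ (e.symm m) = m := e.apply_symm_apply m
  have hse (σ : ℝ) : e.symm (tiltedMean ψ σ) = σ := e.symm_apply_apply σ
  have hsc : Continuous e.symm := e.symm.continuous
  have hsd (m : ℝ) : HasDerivAt e.symm (tiltedVariance ψ (e.symm m))⁻¹ m :=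
    HasDerivAt.of_local_left_inverse hsc.continuousAt (hd _) (hvar _).ne'
      (Filter.Eventually.of_forall hes)
  -- By the tangent inequality for the convex function `φ*`, the supremum is attained at the tilt of
  -- mean `m`. On differentiation the terms containing the derivative of `e.symm` cancel, so `φ' =
  -- e.symm`.
  have hval : cramerTransform ψ = fun m => e.symm m * m - logLaplace ψ (e.symm m) := by
    funext m
    have hle (τ : ℝ) : τ * m - logLaplace ψ τ ≤ e.symm m * m - logLaplace ψ (e.symm m) := by
      have := tangent_le_of_monotone (hasDerivAt_logLaplace hint) hmono.monotone (e.symm m) τ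
      rw [hes] at this
      linarith
    exact le_antisymm (ciSup_le hle) (le_ciSup ⟨_, forall_mem_range.2 hle⟩ (e.symm m))
  have hφ (m : ℝ) : HasDerivAt (cramerTransform ψ) (e.symm m) m := by
    rw [hval]
    have h1 := ((hsd m).mul (hasDerivAt_id m)).sub
      ((hasDerivAt_logLaplace hint (e.symm m)).comp m (hsd m))
    refine h1.congr_deriv ?_
    rw [hes]
    simp
    ring
  obtain ⟨h1, h2⟩ := contDiff_two_of_hasDerivAt hφ hsd
    (((continuous_tiltedVariance hint).comp hsc).inv₀ fun m => (hvar _).ne')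
  exact ⟨e.symm, hes, hse, h1, fun m => by rw [h2]⟩

end Legendre
end CramerConvex

namespace CramerConvex

open MeasureTheory ProbabilityTheory Set Module
open scoped FourierTransform

/-! ### Geometry of the hyperplanes of constant mean. -/

section Slices

variable {K : ℕ}

/-- The constant configuration `1`. -/
noncomputable def ones (K : ℕ) : EuclideanSpace ℝ (Fin K) := WithLp.toLp 2 fun _ => 1

@[simp] lemma ones_apply (i : Fin K) : ones K i = 1 := rfl

/-- Configurations with zero mean. -/
noncomputable abbrev zeroSum (K : ℕ) : Submodule ℝ (EuclideanSpace ℝ (Fin K)) :=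
  (Submodule.span ℝ {ones K})ᗮ

lemma mem_zeroSum {x : EuclideanSpace ℝ (Fin K)} : x ∈ zeroSum K ↔ ∑ i, x i = 0 := by
  rw [Submodule.mem_orthogonal_singleton_iff_inner_right]
  simp [PiLp.inner_apply]

lemma finrank_zeroSum (hK : 1 ≤ K) : finrank ℝ (zeroSum K) = K - 1 := by
  have : Fact (finrank ℝ (EuclideanSpace ℝ (Fin K)) = (K - 1) + 1) :=
    ⟨by rw [finrank_euclideanSpace_fin]; omega⟩
  refine Submodule.finrank_orthogonal_span_singleton fun h => ?_
  have : ones K ⟨0, hK⟩ = 0 := by rw [h]; rfl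
  simp at this

lemma sum_smul_ones_add (t : ℝ) (w : zeroSum K) :
    ∑ i, (t • ones K + (w : EuclideanSpace ℝ (Fin K))) i = K * t := by
  simp [Finset.sum_add_distrib, mem_zeroSum.1 w.2]

lemma range_smul_ones_add (hK : 1 ≤ K) (m : ℝ) :
    range (fun w : zeroSum K => m • ones K + (w : EuclideanSpace ℝ (Fin K))) = meanHyperplane K m := by
  have hK0 : (K : ℝ) ≠ 0 := by positivity
  ext x
  constructor
  · rintro ⟨w, rfl⟩
    simp only [meanHyperplane, mem_ofPred_eq, sum_smul_ones_add]
    field_simp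
  · intro hx
    refine ⟨⟨x - m • ones K, ?_⟩, by simp⟩
    rw [mem_zeroSum]
    simp only [meanHyperplane, mem_ofPred_eq] at hx
    rw [← hx]
    simp
    field_simp
    ring

/-- The hyperplane is an isometric image of `zeroSum K`, on which the normalized Hausdorff measure
of dimension `K - 1` is the volume. -/
lemma setIntegral_meanHyperplane (hK : 1 ≤ K) (m : ℝ) (g : EuclideanSpace ℝ (Fin K) → ℝ) :
    ∫ x in meanHyperplane K m, g x
      ∂(Measure.euclideanHausdorffMeasure (K - 1) : Measure (EuclideanSpace ℝ (Fin K))) =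
    ∫ w : zeroSum K, g (m • ones K + w) := by
  have hiso : Isometry fun w : zeroSum K => m • ones K + (w : EuclideanSpace ℝ (Fin K)) :=
    (isometry_add_left _).comp isometry_subtype_coe
  rw [← range_smul_ones_add hK, ← hiso.map_euclideanHausdorffMeasure,
    hiso.isClosedEmbedding.measurableEmbedding.integral_map]
  congr 1
  rw [← finrank_zeroSum hK]
  exact InnerProductSpace.euclideanHausdorffMeasure_eq_volume

/-- Splitting a configuration into its mean and its fluctuation. -/
noncomputable def meanSplit (hK : 1 ≤ K) :
    (ℝ × zeroSum K) ≃ₗ[ℝ] EuclideanSpace ℝ (Fin K) where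
  toFun p := p.1 • ones K + p.2
  invFun x := ⟨(1 / (K : ℝ)) * ∑ i, x i, ⟨x - ((1 / (K : ℝ)) * ∑ i, x i) • ones K, by
    have hK0 : (K : ℝ) ≠ 0 := by positivity
    rw [mem_zeroSum]
    simp
    field_simp
    ring⟩⟩
  map_add' p q := by
    simp only [Prod.fst_add, Prod.snd_add, Submodule.coe_add]
    module
  map_smul' c p := by
    simp only [Prod.smul_fst, Prod.smul_snd, Submodule.coe_smul, RingHom.id_apply]
    module
  left_inv p := by
    have hK0 : (K : ℝ) ≠ 0 := by positivity
    have h := sum_smul_ones_add p.1 p.2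
    have h2 : 1 / (K : ℝ) * (K * p.1) = p.1 := by field_simp
    refine Prod.ext ?_ (Subtype.ext ?_)
    · simp only [h, h2]
    · simp only [h, h2]; simp
  right_inv x := by simp

lemma meanSplit_apply (hK : 1 ≤ K) (p : ℝ × zeroSum K) :
    meanSplit hK p = p.1 • ones K + p.2 := rfl

/-- Uniqueness of Haar measure. The value of `c` is irrelevant, since it only scales the slice
density and disappears from second derivatives of its logarithm. -/
lemma exists_map_meanSplit (hK : 1 ≤ K) : ∃ c : NNReal, 0 < c ∧
    (volume : Measure (ℝ × zeroSum K)).map (meanSplit hK) = c • volume := by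
  set L := (meanSplit hK).toContinuousLinearEquiv
  have : Measure.IsAddHaarMeasure (volume : Measure (ℝ × zeroSum K)) :=
    Measure.prod.instIsAddHaarMeasure _ _
  have : Measure.IsAddHaarMeasure ((volume : Measure (ℝ × zeroSum K)).map L) :=
    L.isAddHaarMeasure_map volume
  refine ⟨Measure.addHaarScalarFactor ((volume : Measure (ℝ × zeroSum K)).map L) volume,
    Measure.addHaarScalarFactor_pos_of_isAddHaarMeasure _ _, ?_⟩
  exact Measure.isAddLeftInvariant_eq_smul ((volume : Measure (ℝ × zeroSum K)).map L) volume

lemma measurableEmbedding_meanSplit (hK : 1 ≤ K) : MeasurableEmbedding (meanSplit hK) :=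
  ((meanSplit hK).toContinuousLinearEquiv.toHomeomorph).measurableEmbedding

lemma integral_prod_apply (g : ℝ → ℂ) :
    ∫ x : EuclideanSpace ℝ (Fin K), ∏ i, g (x i) = (∫ x, g x) ^ K := by
  have h := integral_fintype_prod_volume_eq_pow (ι := Fin K) g
  rw [Fintype.card_fin] at h
  rw [← h, ← (PiLp.volume_preserving_toLp (Fin K)).integral_comp
    (MeasurableEquiv.toLp 2 (Fin K → ℝ)).measurableEmbedding]

lemma integrable_prod_apply {g : ℝ → ℂ} (hg : Integrable g) :
    Integrable fun x : EuclideanSpace ℝ (Fin K) => ∏ i, g (x i) := by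
  rw [← (PiLp.volume_preserving_toLp (Fin K)).integrable_comp_emb
    (MeasurableEquiv.toLp 2 (Fin K → ℝ)).measurableEmbedding]
  exact Integrable.fintype_prod fun _ => hg

/-- The partition function of the configurations with mean `t`. -/
noncomputable def slicePartition (ψ : ℝ → ℝ) (K : ℕ) (t : ℝ) : ℝ :=
  ∫ w : zeroSum K, Real.exp (-hamiltonian ψ (t • ones K + (w : EuclideanSpace ℝ (Fin K))))

lemma coarseHamiltonian_eq (hK : 1 ≤ K) (ψ : ℝ → ℝ) (m : ℝ) :
    coarseHamiltonian ψ K m = -(1 / (K : ℝ)) * Real.log (slicePartition ψ K m) := by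
  rw [coarseHamiltonian, setIntegral_meanHyperplane hK, slicePartition]

end Slices
end CramerConvex

namespace CramerConvex

open MeasureTheory ProbabilityTheory Set Module
open scoped FourierTransform

/-! ### Regularity and Fourier transform of the slice partition function. -/

section SliceAnalysis

variable {K : ℕ} {ψ : ℝ → ℝ} {B κ x₀ : ℝ}

lemma integrable_gaussian_zeroSum {b : ℝ} (hb : 0 < b) (K : ℕ) :
    Integrable fun w : zeroSum K => Real.exp (-b * ‖w‖ ^ 2) := by
  have h := GaussianFourier.integrable_cexp_neg_mul_sq_norm_add (V := zeroSum K) (b := b)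
    (by simpa using hb) 0 0
  refine h.norm.congr (ae_of_all _ fun w => ?_)
  simp only [Complex.norm_exp]
  congr 1
  simp [← Complex.ofReal_pow, ← Complex.ofReal_neg, ← Complex.ofReal_mul]

/-- Sitewise `(δ + w) ^ 2 ≥ w ^ 2 / 2 - δ ^ 2` with `δ = t - x₀`. The bound `R` makes the majorant
uniform over bounded `t`, for dominated convergence. -/
lemma exp_neg_hamiltonian_le (hκ : 0 ≤ κ) (hb : ∀ x, -ψ x ≤ B - κ * (x - x₀) ^ 2) {t R : ℝ}
    (ht : (t - x₀) ^ 2 ≤ R) (w : zeroSum K) :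
    Real.exp (-hamiltonian ψ (t • ones K + (w : EuclideanSpace ℝ (Fin K)))) ≤
      Real.exp (K * (B + κ * R)) * Real.exp (-(κ / 2) * ‖w‖ ^ 2) := by
  rw [← Real.exp_add]
  refine Real.exp_le_exp.2 ?_
  rw [hamiltonian, ← Finset.sum_neg_distrib]
  have hn : ‖w‖ ^ 2 = ∑ i, (w : EuclideanSpace ℝ (Fin K)) i ^ 2 := by
    rw [show ‖w‖ = ‖(w : EuclideanSpace ℝ (Fin K))‖ from rfl, EuclideanSpace.norm_sq_eq]
    simp
  calc ∑ i, -ψ ((t • ones K + (w : EuclideanSpace ℝ (Fin K))) i)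
      ≤ ∑ i, (B + κ * R - κ / 2 * (w : EuclideanSpace ℝ (Fin K)) i ^ 2) := by
        refine Finset.sum_le_sum fun i _ => (hb _).trans ?_
        simp only [PiLp.add_apply, PiLp.smul_apply, ones_apply, smul_eq_mul, mul_one]
        nlinarith [mul_nonneg hκ (sq_nonneg ((w : EuclideanSpace ℝ (Fin K)) i + 2 * (t - x₀))),
          mul_le_mul_of_nonneg_left ht hκ]
    _ = _ := by
        rw [Finset.sum_sub_distrib, ← Finset.mul_sum, ← hn]
        simp
        ring

lemma continuous_hamiltonian (hψ : Continuous ψ) :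
    Continuous fun x : EuclideanSpace ℝ (Fin K) => hamiltonian ψ x := by
  unfold hamiltonian
  fun_prop

lemma integrable_slice (hψ : Continuous ψ) (hκ : 0 < κ) (hb : ∀ x, -ψ x ≤ B - κ * (x - x₀) ^ 2)
    (t : ℝ) : Integrable fun w : zeroSum K =>
      Real.exp (-hamiltonian ψ (t • ones K + (w : EuclideanSpace ℝ (Fin K)))) := by
  refine ((integrable_gaussian_zeroSum (half_pos hκ) K).const_mul
    (Real.exp (K * (B + κ * (t - x₀) ^ 2)))).mono' ?_ (ae_of_all _ fun w => ?_)
  · have := continuous_hamiltonian (K := K) hψ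
    exact Continuous.aestronglyMeasurable (by fun_prop)
  · rw [Real.norm_of_nonneg (Real.exp_pos _).le]
    exact exp_neg_hamiltonian_le hκ.le hb le_rfl w

lemma slicePartition_pos (hψ : Continuous ψ) (hκ : 0 < κ)
    (hb : ∀ x, -ψ x ≤ B - κ * (x - x₀) ^ 2) (t : ℝ) : 0 < slicePartition ψ K t :=
  integral_exp_pos (integrable_slice hψ hκ hb t)

lemma continuous_slicePartition (hψ : Continuous ψ) (hκ : 0 < κ)
    (hb : ∀ x, -ψ x ≤ B - κ * (x - x₀) ^ 2) : Continuous (slicePartition ψ K) := by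
  have hH := continuous_hamiltonian (K := K) hψ
  refine continuous_iff_continuousAt.2 fun t₀ => ?_
  refine continuousAt_of_dominated (bound := fun w : zeroSum K =>
    Real.exp (K * (B + κ * ((t₀ - x₀) ^ 2 + 1))) * Real.exp (-(κ / 2) * ‖w‖ ^ 2)) ?_ ?_
    ((integrable_gaussian_zeroSum (half_pos hκ) K).const_mul _) ?_
  · exact Filter.Eventually.of_forall fun t => Continuous.aestronglyMeasurable (by fun_prop)
  · have h : ∀ᶠ t in nhds t₀, (t - x₀) ^ 2 < (t₀ - x₀) ^ 2 + 1 := by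
      have hc : ContinuousAt (fun t : ℝ => (t - x₀) ^ 2) t₀ := by fun_prop
      exact hc.eventually (gt_mem_nhds (by linarith))
    filter_upwards [h] with t ht
    refine ae_of_all _ fun w => ?_
    rw [Real.norm_of_nonneg (Real.exp_pos _).le]
    exact exp_neg_hamiltonian_le hκ.le hb ht.le w
  · exact ae_of_all _ fun w => Continuous.continuousAt (by fun_prop)

/-- The tilted slice partition function, the density of the mean up to a constant. -/
noncomputable def tiltedSlice (ψ : ℝ → ℝ) (K : ℕ) (σ t : ℝ) : ℝ :=
  Real.exp (K * σ * t) * slicePartition ψ K t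

lemma prod_exp_eq (ψ : ℝ → ℝ) (σ : ℝ) (p : ℝ × zeroSum K) (hK : 1 ≤ K) :
    ∏ i, ((Real.exp (σ * meanSplit hK p i - ψ (meanSplit hK p i)) : ℝ) : ℂ) =
      ((Real.exp (K * σ * p.1) * Real.exp (-hamiltonian ψ
        (p.1 • ones K + (p.2 : EuclideanSpace ℝ (Fin K)))) : ℝ) : ℂ) := by
  rw [← Complex.ofReal_prod, ← Real.exp_sum, ← Real.exp_add, Finset.sum_sub_distrib,
    ← Finset.mul_sum, meanSplit_apply, sum_smul_ones_add, hamiltonian]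
  congr 2
  ring

/-- Since `∑ i, x i = K * t` on the slice, the phase `exp (2πivt)` is a product over sites of phases
of frequency `2πv/K`. By Fubini the transform is an integral of a product function over `ℝ^K`, hence
a `K`-th power. -/
lemma exists_fourier_tiltedSlice (hK : 1 ≤ K)
    (hint : ∀ σ, Integrable fun x => Real.exp (σ * x - ψ x)) : ∃ c : ℝ, 0 < c ∧ ∀ σ : ℝ,
    Integrable (fun t => (tiltedSlice ψ K σ t : ℂ)) ∧ ∀ v : ℝ,
      𝓕⁻ (fun t => (tiltedSlice ψ K σ t : ℂ)) v =
        (c * (∫ x, Real.exp (σ * x - ψ x)) ^ K : ℝ) *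
          charFun (tiltedMeasure ψ σ) (2 * Real.pi * v / K) ^ K := by
  obtain ⟨c, hc, hmap⟩ := exists_map_meanSplit hK
  have hK0 : (K : ℝ) ≠ 0 := by positivity
  refine ⟨c, hc, fun σ => ?_⟩
  have hemb := measurableEmbedding_meanSplit hK
  have hslice (t : ℝ) : (tiltedSlice ψ K σ t : ℂ) = ∫ w : zeroSum K,
      ∏ i, ((Real.exp (σ * meanSplit hK (t, w) i - ψ (meanSplit hK (t, w) i)) : ℝ) : ℂ) := by
    simp_rw [prod_exp_eq]
    rw [integral_complex_ofReal, integral_const_mul]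
    rfl
  have hprod {g : ℝ → ℂ} (hg : Integrable g) :
      Integrable fun p : ℝ × zeroSum K => ∏ i, g (meanSplit hK p i) := by
    have h := integrable_prod_apply (K := K) hg
    have h2 : Integrable (fun x : EuclideanSpace ℝ (Fin K) => ∏ i, g (x i))
        ((volume : Measure (ℝ × zeroSum K)).map (meanSplit hK)) := by
      rw [hmap]
      exact h.smul_measure_nnreal
    exact (hemb.integrable_map_iff).1 h2
  have hreal : Integrable fun x : ℝ => ((Real.exp (σ * x - ψ x) : ℝ) : ℂ) := (hint σ).ofReal
  constructor
  · simp_rw [hslice]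
    exact (hprod hreal).integral_prod_left
  · intro v
    set g : ℝ → ℂ := fun x => Complex.exp ((2 * Real.pi * v / K : ℝ) * x * Complex.I) *
      ((Real.exp (σ * x - ψ x) : ℝ) : ℂ) with hg
    have hgi : Integrable g := by
      refine hreal.bdd_mul (c := 1) (Continuous.aestronglyMeasurable (by fun_prop))
        (ae_of_all _ fun x => ?_)
      rw [← Complex.ofReal_mul, Complex.norm_exp_ofReal_mul_I]
    have hgprod (p : ℝ × zeroSum K) : ∏ i, g (meanSplit hK p i) =
        Complex.exp ((2 * Real.pi * v * p.1 : ℝ) * Complex.I) *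
        ∏ i, ((Real.exp (σ * meanSplit hK p i - ψ (meanSplit hK p i)) : ℝ) : ℂ) := by
      rw [hg, Finset.prod_mul_distrib, ← Complex.exp_sum]
      congr 2
      rw [← Finset.sum_mul, ← Finset.mul_sum, ← Complex.ofReal_sum, meanSplit_apply,
        sum_smul_ones_add, ← Complex.ofReal_mul]
      congr 2
      field_simp
    have h1 : 𝓕⁻ (fun t => (tiltedSlice ψ K σ t : ℂ)) v =
        ∫ t : ℝ, ∫ w : zeroSum K, ∏ i, g (meanSplit hK (t, w) i) := by
      rw [Real.fourierInv_eq']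
      refine integral_congr_ae (ae_of_all _ fun t => ?_)
      simp only [hgprod, integral_const_mul, ← hslice, smul_eq_mul]
      congr 3
      simp
      ring
    have h2 : ∫ t : ℝ, ∫ w : zeroSum K, ∏ i, g (meanSplit hK (t, w) i) =
        ∫ p : ℝ × zeroSum K, ∏ i, g (meanSplit hK p i) :=
      (integral_prod _ (hprod hgi)).symm
    have h3 : ∫ p : ℝ × zeroSum K, ∏ i, g (meanSplit hK p i) = c * (∫ x, g x) ^ K := by
      have := hemb.integral_map (μ := volume)
        (fun x : EuclideanSpace ℝ (Fin K) => ∏ i, g (x i))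
      rw [← this, hmap, integral_smul_nnreal_measure, integral_prod_apply]
      rfl
    have h4 : ∫ x, g x = (∫ x, Real.exp (σ * x - ψ x) : ℝ) *
        charFun (tiltedMeasure ψ σ) (2 * Real.pi * v / K) := by
      rw [charFun_apply_real, tiltedMeasure, integral_tilted, ← integral_const_mul]
      refine integral_congr_ae (ae_of_all _ fun x => ?_)
      have hN : (∫ x, Real.exp (σ * x - ψ x)) ≠ 0 := (integral_exp_pos (hint σ)).ne'
      have hN' : ((∫ x, Real.exp (σ * x - ψ x) : ℝ) : ℂ) ≠ 0 := by exact_mod_cast hN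
      simp only [hg, Complex.real_smul, Complex.ofReal_div]
      field_simp
    rw [h1, h2, h3, h4]
    push_cast
    ring

end SliceAnalysis
end CramerConvex

namespace CramerConvex

open MeasureTheory ProbabilityTheory Set Module
open scoped FourierTransform

/-! ### Differentiation under Fourier inversion. -/

section FourierDerivatives

lemma hasDerivAt_re_of_ofReal {r : ℝ → ℝ} {f : ℝ → ℂ} (hf : ∀ t, f t = r t) {d : ℂ} {t : ℝ}
    (h : HasDerivAt f d t) : HasDerivAt r d.re t ∧ ((d.re : ℝ) : ℂ) = d := by
  have h1 : HasDerivAt r d.re t := by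
    have := Complex.reCLM.hasFDerivAt.comp_hasDerivAt t h
    refine HasDerivAt.congr_of_eventuallyEq this (Filter.Eventually.of_forall fun x => ?_)
    simp [hf]
  have h2 : HasDerivAt f ((d.re : ℝ) : ℂ) t := by
    rw [funext hf]
    exact h1.ofReal_comp
  exact ⟨h1, h2.unique h⟩

/-- A continuous integrable real function whose Fourier transform has two absolute moments is
twice continuously differentiable, with derivatives given by Fourier integrals. -/
lemma exists_derivs_of_fourier {P : ℝ → ℝ} (hc : Continuous P)
    (hi : Integrable fun t => (P t : ℂ)) {g : ℝ → ℂ} (hg : 𝓕⁻ (fun t => (P t : ℂ)) = g)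
    (hgi : ∀ j ≤ 2, Integrable fun v : ℝ => (v : ℂ) ^ j * g v) :
    ∃ P₁ P₂ : ℝ → ℝ, (∀ t, HasDerivAt P (P₁ t) t) ∧ (∀ t, HasDerivAt P₁ (P₂ t) t) ∧
      Continuous P₂ ∧ ∀ t, (P t : ℂ) = ∫ v : ℝ, Complex.exp (-(2 * Real.pi * v * t) * Complex.I) * g v ∧
        (P₁ t : ℂ) = (-2 * Real.pi * Complex.I) *
          ∫ v : ℝ, Complex.exp (-(2 * Real.pi * v * t) * Complex.I) * (v * g v) ∧
        (P₂ t : ℂ) = (-2 * Real.pi * Complex.I) ^ 2 *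
          ∫ v : ℝ, Complex.exp (-(2 * Real.pi * v * t) * Complex.I) * (v ^ 2 * g v) := by
  set a : ℂ := -2 * Real.pi * Complex.I with ha
  have hg0 : Integrable g := by simpa using hgi 0 (by norm_num)
  have hg1 : Integrable fun v : ℝ => (v : ℂ) * g v := by simpa using hgi 1 (by norm_num)
  have hg2 : Integrable fun v : ℝ => (v : ℂ) ^ 2 * g v := hgi 2 le_rfl
  set g₁ : ℝ → ℂ := fun v => (a * v) • g v with hg₁
  set g₂ : ℝ → ℂ := fun v => (a * v) • g₁ v with hg₂
  have i1 : Integrable g₁ := by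
    refine (hg1.const_mul a).congr (ae_of_all _ fun v => ?_)
    simp only [hg₁, smul_eq_mul]; ring
  have i2 : Integrable g₂ := by
    refine (hg2.const_mul (a ^ 2)).congr (ae_of_all _ fun v => ?_)
    simp only [hg₂, hg₁, smul_eq_mul]; ring
  have hP : 𝓕 g = fun t => (P t : ℂ) := by
    rw [← hg]
    have hcc : Continuous fun t => (P t : ℂ) := by fun_prop
    refine hcc.fourier_fourierInv_eq hi ?_
    have : 𝓕 (fun t => (P t : ℂ)) = fun v => g (-v) := by
      rw [← hg]
      funext v
      rw [Real.fourierInv_eq_fourier_neg, neg_neg]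
    rw [this]
    exact hg0.comp_neg
  have d0 (t : ℝ) : HasDerivAt (𝓕 g) (𝓕 g₁ t) t := by
    refine Real.hasDerivAt_fourier hg0 ?_ t
    refine hg1.congr (ae_of_all _ fun v => ?_)
    simp
  have d1 (t : ℝ) : HasDerivAt (𝓕 g₁) (𝓕 g₂ t) t := by
    refine Real.hasDerivAt_fourier i1 ?_ t
    refine (hg2.const_mul a).congr (ae_of_all _ fun v => ?_)
    simp only [hg₁, smul_eq_mul, Complex.real_smul]; ring
  have r1 (t : ℝ) := hasDerivAt_re_of_ofReal (fun t => congrFun hP t) (d0 t)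
  have r2 (t : ℝ) := hasDerivAt_re_of_ofReal (fun t => (r1 t).2.symm) (d1 t)
  have hfour (h : ℝ → ℂ) (t : ℝ) :
      𝓕 h t = ∫ v : ℝ, Complex.exp (-(2 * Real.pi * v * t) * Complex.I) * h v := by
    rw [Real.fourier_real_eq_integral_exp_smul]
    refine integral_congr_ae (ae_of_all _ fun v => ?_)
    simp only [smul_eq_mul]
    congr 2
    push_cast
    ring
  have hcont : Continuous (𝓕 g₂) := by
    have := VectorFourier.fourierIntegral_continuous (Real.continuous_fourierChar)
      (innerSL ℝ).continuous₂ i2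
    exact this
  refine ⟨fun t => (𝓕 g₁ t).re, fun t => (𝓕 g₂ t).re, fun t => (r1 t).1, fun t => (r2 t).1,
    Complex.continuous_re.comp hcont, fun t => ⟨?_, ?_, ?_⟩⟩
  · rw [← hfour, hP]
  · rw [(r1 t).2, hfour, ← integral_const_mul]
    refine integral_congr_ae (ae_of_all _ fun v => ?_)
    simp only [hg₁, smul_eq_mul]
    ring
  · rw [(r2 t).2, hfour, ← integral_const_mul]
    refine integral_congr_ae (ae_of_all _ fun v => ?_)
    simp only [hg₂, hg₁, smul_eq_mul]
    ring

end FourierDerivatives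

/-! ### The second derivative of the coarse-grained Hamiltonian. -/

section Coarse

variable {ψ : ℝ → ℝ} {K : ℕ} {M A : ℝ}

lemma charFun_eq_mul_charFun_map (μ : Measure ℝ) (m : ℝ) {s : ℝ} (hs : s ≠ 0) (u : ℝ) :
    charFun μ u = Complex.exp (u * m * Complex.I) *
      charFun (μ.map fun x => s⁻¹ * (x - m)) (s * u) := by
  rw [charFun_map_mul_comp (by fun_prop)]
  simp_rw [sub_eq_add_neg]
  rw [charFun_map_add_const, inv_mul_cancel_left₀ hs, mul_left_comm, ← Complex.exp_add]
  have : (u * m * Complex.I + (inner ℝ (-m) u : ℝ) * Complex.I : ℂ) = 0 := by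
    simp
  rw [this]
  simp

/-- The coarse-grained Hamiltonian is `C²`, and its second derivative at the mean of `μ^σ` is
expressed through the moments of the `K`-th power of the normalized characteristic function. -/
theorem coarseHamiltonian_second_deriv (hM : 0 ≤ M) (hA : 1 ≤ A) (hK : 26 ≤ K)
    (hint : ∀ σ, Integrable fun x => Real.exp (σ * x - ψ x))
    (hcont : Continuous (slicePartition ψ K)) (hpos : ∀ t, 0 < slicePartition ψ K t) (σ : ℝ)
    (hV : 0 < tiltedVariance ψ σ)
    (hν : Normalized ((tiltedMeasure ψ σ).map fun x =>
      (√(tiltedVariance ψ σ))⁻¹ * (x - tiltedMean ψ σ)) M A) :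
    let ν := (tiltedMeasure ψ σ).map fun x => (√(tiltedVariance ψ σ))⁻¹ * (x - tiltedMean ψ σ)
    let G : ℕ → ℂ := fun j => ∫ x : ℝ, (x : ℂ) ^ j * charFun ν (x / √K) ^ K
    ContDiff ℝ 2 (coarseHamiltonian ψ K) ∧ G 0 ≠ 0 ∧
      ((iteratedDeriv 2 (coarseHamiltonian ψ K) (tiltedMean ψ σ) : ℝ) : ℂ) =
        (tiltedVariance ψ σ : ℂ)⁻¹ * ((G 2 * G 0 - G 1 ^ 2) / G 0 ^ 2) := by
  intro ν G
  have hprobμ : IsProbabilityMeasure (tiltedMeasure ψ σ) := isProbabilityMeasure_tilted (hint σ)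
  have hprobν : IsProbabilityMeasure ν := Measure.isProbabilityMeasure_map (by fun_prop)
  set V := tiltedVariance ψ σ with hVdef
  set m := tiltedMean ψ σ with hm
  set s := √V with hs
  have hs0 : 0 < s := Real.sqrt_pos.2 hV
  have hs2 : s ^ 2 = V := Real.sq_sqrt hV.le
  have hK1 : 1 ≤ K := by omega
  have hK0 : (0 : ℝ) < K := by positivity
  have hKs : 0 < √(K : ℝ) := Real.sqrt_pos.2 hK0
  obtain ⟨c, hc, hF⟩ := exists_fourier_tiltedSlice hK1 hint
  obtain ⟨hPi, hPF⟩ := hF σ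
  set N := c * (∫ x, Real.exp (σ * x - ψ x)) ^ K with hN
  have hN0 : 0 < N := mul_pos hc (pow_pos (integral_exp_pos (hint σ)) K)
  -- The scale from the Fourier frequency `v` to the normalized variable: `s * (2πv / K) = α v /
  -- √K`.
  set α := 2 * Real.pi * s / √K with hα
  have hα0 : 0 < α := by positivity
  set h : ℝ → ℂ := fun x => charFun ν (x / √K) ^ K with hh
  set g : ℝ → ℂ := fun v => N * (Complex.exp (2 * Real.pi * v * m * Complex.I) * h (α * v)) with hg
  have hPg : 𝓕⁻ (fun t => (tiltedSlice ψ K σ t : ℂ)) = g := by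
    funext v
    rw [hPF, hg, charFun_eq_mul_charFun_map (tiltedMeasure ψ σ) m hs0.ne', mul_pow,
      ← Complex.exp_nat_mul]
    simp only [hh]
    have e1 : s * (2 * Real.pi * v / K) = α * v / √K := by
      rw [hα]
      have : √(K : ℝ) * √K = K := Real.mul_self_sqrt hK0.le
      field_simp
      rw [sq, this]
    have e2 : (K : ℂ) * (((2 * Real.pi * v / K : ℝ) : ℂ) * m * Complex.I) =
        2 * Real.pi * v * m * Complex.I := by
      have : (K : ℂ) ≠ 0 := by exact_mod_cast hK0.ne'
      push_cast
      field_simp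
    rw [e1, e2]
  have hI (j : ℕ) (hj : j ≤ 2) : Integrable fun v : ℝ => (v : ℂ) ^ j * h (α * v) := by
    have h1 := (hν.integrable_pow_mul hM hA hK (j := j) (by omega)).comp_mul_left' hα0.ne'
    refine (h1.const_mul (((α⁻¹ : ℝ) : ℂ) ^ j)).congr (ae_of_all _ fun v => ?_)
    have : (α : ℂ) ≠ 0 := by exact_mod_cast hα0.ne'
    simp only
    rw [← mul_assoc, ← mul_pow]
    push_cast
    rw [inv_mul_cancel_left₀ this]
  have hgi (j : ℕ) (hj : j ≤ 2) : Integrable fun v : ℝ => (v : ℂ) ^ j * g v := by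
    have h1 := (hI j hj).bdd_mul (c := 1)
      (f := fun v : ℝ => Complex.exp (2 * Real.pi * v * m * Complex.I))
      (Continuous.aestronglyMeasurable (by fun_prop)) (ae_of_all _ fun v => by
        have : (2 * Real.pi * v * m * Complex.I : ℂ) =
            ((2 * Real.pi * v * m : ℝ) : ℂ) * Complex.I := by push_cast; ring
        rw [this, Complex.norm_exp_ofReal_mul_I])
    refine (h1.const_mul (N : ℂ)).congr (ae_of_all _ fun v => ?_)
    simp only [hg]
    ring
  have hPc : Continuous (tiltedSlice ψ K σ) := by
    unfold tiltedSlice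
    fun_prop
  have hPpos (t : ℝ) : 0 < tiltedSlice ψ K σ t := mul_pos (Real.exp_pos _) (hpos t)
  obtain ⟨P₁, P₂, hd1, hd2, hP2c, hval⟩ := exists_derivs_of_fourier hPc hPi hPg hgi
  have hcoarse : coarseHamiltonian ψ K =
      fun t => -(1 / (K : ℝ)) * (Real.log (tiltedSlice ψ K σ t) - K * σ * t) := by
    funext t
    rw [coarseHamiltonian_eq hK1, tiltedSlice, Real.log_mul (Real.exp_pos _).ne' (hpos t).ne',
      Real.log_exp]
    ring
  have hc1 (t : ℝ) : HasDerivAt (coarseHamiltonian ψ K)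
      (-(1 / (K : ℝ)) * (P₁ t / tiltedSlice ψ K σ t - K * σ)) t := by
    rw [hcoarse]
    refine HasDerivAt.const_mul _ (((hd1 t).log (hPpos t).ne').sub ?_)
    simpa using (hasDerivAt_id t).const_mul (K * σ)
  have hc2 (t : ℝ) : HasDerivAt (fun t => -(1 / (K : ℝ)) * (P₁ t / tiltedSlice ψ K σ t - K * σ))
      (-(1 / (K : ℝ)) * ((P₂ t * tiltedSlice ψ K σ t - P₁ t * P₁ t) / tiltedSlice ψ K σ t ^ 2)) t :=
    (((hd2 t).div (hd1 t) (hPpos t).ne').sub_const _).const_mul _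
  have hP1c : Continuous P₁ := continuous_iff_continuousAt.2 fun t => (hd2 t).continuousAt
  obtain ⟨hC2, hit⟩ := contDiff_two_of_hasDerivAt hc1 hc2
    (continuous_const.mul (((hP2c.mul hPc).sub (hP1c.mul hP1c)).div (hPc.pow 2)
      fun t => (pow_pos (hPpos t) 2).ne'))
  -- At `t = m` the inversion phase cancels the phase produced by the mean of `μ^σ`, leaving pure
  -- moments of `h`.
  have hmom (j : ℕ) (g' : ℝ → ℂ) (hg' : ∀ v : ℝ, g' v = (v : ℂ) ^ j * g v) :
      ∫ v : ℝ, Complex.exp (-(2 * Real.pi * v * m) * Complex.I) * g' v =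
        (N / α : ℂ) * ((α : ℂ)⁻¹ ^ j * G j) := by
    have e1 (v : ℝ) : Complex.exp (-(2 * Real.pi * v * m) * Complex.I) * g' v =
        (N : ℂ) * ((α : ℂ)⁻¹ ^ j * (((α * v : ℝ) : ℂ) ^ j * h (α * v))) := by
      have e2 : Complex.exp (-(2 * Real.pi * v * m) * Complex.I) *
          Complex.exp (2 * Real.pi * v * m * Complex.I) = 1 := by
        rw [← Complex.exp_add, neg_mul, neg_add_cancel, Complex.exp_zero]
      have e3 : (α : ℂ)⁻¹ ^ j * ((α * v : ℝ) : ℂ) ^ j = (v : ℂ) ^ j := by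
        have : (α : ℂ) ≠ 0 := by exact_mod_cast hα0.ne'
        rw [← mul_pow]
        push_cast
        rw [inv_mul_cancel_left₀ this]
      rw [← mul_assoc ((α : ℂ)⁻¹ ^ j), e3, hg', hg]
      linear_combination ((v : ℂ) ^ j * N * h (α * v)) * e2
    simp_rw [e1]
    rw [integral_const_mul, integral_const_mul,
      Measure.integral_comp_mul_left (fun x : ℝ => (x : ℂ) ^ j * h x) α, abs_of_pos (inv_pos.2 hα0),
      Complex.real_smul]
    push_cast
    ring
  obtain ⟨v0, v1, v2⟩ := hval m
  rw [hmom 0 g (fun v => by simp)] at v0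
  rw [hmom 1 (fun v => v * g v) (fun v => by simp)] at v1
  rw [hmom 2 (fun v => v ^ 2 * g v) (fun v => rfl)] at v2
  have hαC : (α : ℂ) ≠ 0 := by exact_mod_cast hα0.ne'
  have hNC : (N : ℂ) ≠ 0 := by exact_mod_cast hN0.ne'
  have hVC : (V : ℂ) ≠ 0 := by exact_mod_cast hV.ne'
  have hKC : (K : ℂ) ≠ 0 := by exact_mod_cast hK0.ne'
  have hG0 : G 0 ≠ 0 := by
    intro h0
    rw [h0] at v0
    simp only [mul_zero] at v0
    exact (hPpos m).ne' (by exact_mod_cast v0)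
  -- This identity collapses the prefactor `(1/K) (2π)² α⁻²` to `1/V`.
  have hα2 : (2 * Real.pi) ^ 2 * V = α ^ 2 * K := by
    rw [hα, div_pow, Real.sq_sqrt hK0.le, ← hs2]
    field_simp
  have hα2C : ((2 * Real.pi) ^ 2 * V : ℂ) = α ^ 2 * K := by exact_mod_cast hα2
  refine ⟨hC2, hG0, ?_⟩
  rw [hit]
  push_cast
  rw [v0, v1, v2]
  have hsq : (-2 * Real.pi * Complex.I : ℂ) ^ 2 = -(2 * Real.pi) ^ 2 := by
    rw [mul_pow, Complex.I_sq]; ring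
  have hpi : ((2 * Real.pi) ^ 2 : ℂ) = α ^ 2 * K / V := by
    rw [← hα2C]; field_simp
  have e4 : ((-2 * Real.pi * Complex.I : ℂ) ^ 2 * (N / α * ((α : ℂ)⁻¹ ^ 2 * G 2))) *
      (N / α * ((α : ℂ)⁻¹ ^ 0 * G 0)) - (-2 * Real.pi * Complex.I) * (N / α * ((α : ℂ)⁻¹ ^ 1 * G 1)) *
      ((-2 * Real.pi * Complex.I) * (N / α * ((α : ℂ)⁻¹ ^ 1 * G 1))) =
      (-2 * Real.pi * Complex.I : ℂ) ^ 2 * ((N / α) ^ 2 * (α : ℂ)⁻¹ ^ 2 * (G 2 * G 0 - G 1 ^ 2)) := by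
    ring
  rw [e4, hsq, hpi]
  field_simp

end Coarse
end CramerConvex

/-! ### Conclusion. -/

namespace CramerConvex

open MeasureTheory ProbabilityTheory Set Module
open scoped FourierTransform

/-- The difference is `V⁻¹` times `-(G₂ - G₀) / G₀ + (G₁ / G₀) ^ 2`. As `G₁` enters squared, order
`1/√K` suffices for it. -/
lemma norm_inv_sub_ratio_le {V C K : ℝ} (hV : 0 < V) (hK : 0 < K) {G₀ G₁ G₂ : ℂ}
    (h0 : 1 ≤ ‖G₀‖) (h1 : ‖G₁‖ ≤ C / √K) (h2 : ‖G₂ - G₀‖ ≤ C / K) :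
    ‖(V : ℂ)⁻¹ - (V : ℂ)⁻¹ * ((G₂ * G₀ - G₁ ^ 2) / G₀ ^ 2)‖ ≤ (C + C ^ 2) / (K * V) := by
  have hG : G₀ ≠ 0 := norm_pos_iff.1 (by linarith)
  have e : (V : ℂ)⁻¹ - (V : ℂ)⁻¹ * ((G₂ * G₀ - G₁ ^ 2) / G₀ ^ 2) =
      (V : ℂ)⁻¹ * (-((G₂ - G₀) / G₀) + (G₁ / G₀) ^ 2) := by
    field_simp
    ring
  have b1 : ‖(G₂ - G₀) / G₀‖ ≤ C / K := by
    rw [norm_div]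
    exact (div_le_self (norm_nonneg _) h0).trans h2
  have b2 : ‖(G₁ / G₀) ^ 2‖ ≤ C ^ 2 / K := by
    have : ‖G₁ / G₀‖ ≤ C / √K := by
      rw [norm_div]
      exact (div_le_self (norm_nonneg _) h0).trans h1
    rw [norm_pow]
    refine (pow_le_pow_left₀ (norm_nonneg _) this 2).trans (le_of_eq ?_)
    rw [div_pow, Real.sq_sqrt hK.le]
  rw [e, norm_mul, norm_inv, Complex.norm_real, Real.norm_of_nonneg hV.le]
  calc V⁻¹ * ‖-((G₂ - G₀) / G₀) + (G₁ / G₀) ^ 2‖ ≤ V⁻¹ * (C / K + C ^ 2 / K) := by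
        gcongr
        refine (norm_add_le _ _).trans ?_
        rw [norm_neg]
        exact add_le_add b1 b2
    _ = _ := by field_simp

end CramerConvex

open CramerConvex MeasureTheory ProbabilityTheory

theorem lemma3p3 (ψ : ℝ → ℝ) (hψ : CramerConvex.PerturbedStrictlyConvex ψ) :
    (∀ m : ℝ, ∃! σ : ℝ, CramerConvex.tiltedMean ψ σ = m) ∧
    ContDiff ℝ 2 (CramerConvex.cramerTransform ψ) ∧
    ∃ C : ℝ, 0 < C ∧ ∃ K₀ : ℕ, 1 ≤ K₀ ∧ ∀ K : ℕ, K₀ ≤ K →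
      ContDiff ℝ 2 (CramerConvex.coarseHamiltonian ψ K) ∧
      ∀ m σ : ℝ, CramerConvex.tiltedMean ψ σ = m →
        0 < CramerConvex.tiltedVariance ψ σ ∧
        |iteratedDeriv 2 (CramerConvex.cramerTransform ψ) m
            - iteratedDeriv 2 (CramerConvex.coarseHamiltonian ψ K) m|
          ≤ C / ((K : ℝ) * CramerConvex.tiltedVariance ψ σ) := by
  obtain ⟨c, D, hc, hD, g, d, hgs, hwell⟩ := hψ.exists_perturbedWell
  obtain ⟨M, A, S, hM, hA, hnorm⟩ := PerturbedWell.exists_normalized (c := c) hD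
  have hfacts (x₀ : ℝ) : 0 < tiltedVariance ψ (g x₀) ∧ |tiltedMean ψ (g x₀) - x₀| ≤ S ∧
      Normalized ((tiltedMeasure ψ (g x₀)).map fun x =>
        (√(tiltedVariance ψ (g x₀)))⁻¹ * (x - tiltedMean ψ (g x₀))) M A := by
    obtain ⟨U, a, h⟩ := hwell x₀
    exact hnorm _ U d x₀ a h
  have hint (σ : ℝ) : Integrable fun x => Real.exp (σ * x - ψ x) := by
    obtain ⟨x₀, rfl⟩ := hgs σ
    obtain ⟨U, a, h⟩ := hwell x₀
    exact h.integrable_exp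
  have hvar (σ : ℝ) : 0 < tiltedVariance ψ σ := by
    obtain ⟨x₀, rfl⟩ := hgs σ
    exact (hfacts x₀).1
  have hnu (σ : ℝ) : Normalized ((tiltedMeasure ψ σ).map fun x =>
      (√(tiltedVariance ψ σ))⁻¹ * (x - tiltedMean ψ σ)) M A := by
    obtain ⟨x₀, rfl⟩ := hgs σ
    exact (hfacts x₀).2.2
  -- The mean of the tilt `g x₀` is within `S` of `x₀`, so `x₀ = m - S` and `x₀ = m + S` give means
  -- on either side of `m`.
  obtain ⟨s, hs1, hs2, hφ, hφ2⟩ := exists_tilt hint hvar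
    (fun m => ⟨g (m - S), by linarith [le_of_abs_le (hfacts (m - S)).2.1]⟩)
    (fun m => ⟨g (m + S), by linarith [neg_le_of_abs_le (hfacts (m + S)).2.1]⟩)
  obtain ⟨x₀, hx₀⟩ := hgs 0
  obtain ⟨U, a, hU⟩ := hwell x₀
  rw [hx₀] at hU
  have hψc : Continuous ψ := by
    have := hU.continuous.neg
    refine this.congr fun x => ?_
    simp
  have hψb (x : ℝ) : -ψ x ≤ (a + D) - c / 2 * (x - x₀) ^ 2 := by
    have h1 := hU.eq x
    have h2 := hU.well.growth x
    have h3 := neg_le_of_abs_le (hU.bound x)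
    linarith
  obtain ⟨C, hC, K₀, hK₀, hbounds⟩ := exists_normalized_bounds hM hA
  refine ⟨fun m => ⟨s m, hs1 m, fun σ hσ => by rw [← hσ, hs2]⟩, hφ, C + C ^ 2, by positivity,
    K₀, by omega, fun K hK => ?_⟩
  have hmain (σ : ℝ) := coarseHamiltonian_second_deriv hM hA (hK₀.trans hK) hint
    (continuous_slicePartition hψc (half_pos hc) hψb)
    (slicePartition_pos hψc (half_pos hc) hψb) σ (hvar σ) (hnu σ)
  -- The `C²` conclusion does not involve the tilt, so any value of `σ` serves.
  refine ⟨(hmain 0).1, ?_⟩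
  rintro m σ rfl
  refine ⟨hvar σ, ?_⟩
  obtain ⟨-, -, hder⟩ := hmain σ
  have hprobμ : IsProbabilityMeasure (tiltedMeasure ψ σ) := isProbabilityMeasure_tilted (hint σ)
  have hprobν : IsProbabilityMeasure ((tiltedMeasure ψ σ).map fun x =>
      (√(tiltedVariance ψ σ))⁻¹ * (x - tiltedMean ψ σ)) :=
    Measure.isProbabilityMeasure_map (by fun_prop)
  obtain ⟨b0, b1, b2⟩ := hbounds _ (hnu σ) K hK
  have hK0 : (0 : ℝ) < K := by
    have : 0 < K := by omega
    exact_mod_cast this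
  rw [← Real.norm_eq_abs, ← Complex.norm_real]
  push_cast
  rw [hder, hφ2, hs2]
  push_cast
  refine norm_inv_sub_ratio_le (hvar σ) hK0 ?_ ?_ ?_
  · simpa using b0
  · simpa using b1
  · simpa using b2
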